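/- Let $n\ge 1$ and let $\xi_1,\dots,\xi_n$ be independent, non-degenerate (not almost surely constant) real random variables on a probability space $(\Omega,\mathcal F,\mathbf P)$ with $\mathbf E\xi_i=0$. Put $S_n=\sum_{i=1}^n\xi_i$ and $\sigma^2=\sum_{i=1}^n\mathbf E\xi_i^2$, $\sigma>0$. Let $\delta\in(0,1]$ and $B>0$, and assume that $\xi_i\le B$ almost surely and $\mathbf E|\xi_i|^{2+\delta}<\infty$ for all $1\le i\le n$. Notation. $\Phi$ is the standard normal distribution function and $\Theta(y)=(1-\Phi(y))e^{y^2/2}$. For $\lambda\ge 0$ let $\Psi_n(\lambda)=\sum_{i=1}^n\log\mathbf E e^{\lambda\xi_i}$ (its derivative at $\lambda=0$ is the right derivative), let $\mathbf P_\lambda$ be the conjugate (Esscher) measure $$d\mathbf P_\lambda=\prod_{i=1}^n\frac{e^{\lambda\xi_i}}{\mathbf E e^{\lambda\xi_i}}\,d\mathbf P,$$ with expectation $\mathbf E_\lambda$, and let $$\overline\sigma(\lambda)=\Big(\mathbf E_\lambda\Big(\sum_{i=1}^n(\xi_i-\mathbf E_\lambda\xi_i)\Big)^2\Big)^{1/2}$$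 be the standard deviation of $S_n$ under $\mathbf P_\lambda$. Finally, $C_{2+\delta}$ is the least real constant $C$ such that $$\sup_{y\in\mathbf R}\Big|\mathbf P\Big(\sum_{i=1}^m\zeta_i\le y s\Big)-\Phi(y)\Big|\le C\,\frac{\sum_{i=1}^m\mathbf E|\zeta_i|^{2+\delta}}{s^{2+\delta}},\qquad s=\Big(\sum_{i=1}^m\mathbf E\zeta_i^2\Big)^{1/2},$$ for all $m\ge 1$ and all independent, non-degenerate, centered real random variables $\zeta_1,\dots,\zeta_m$ with finite absolute moments of order $2+\delta$, on any probability space. Theorem. Let $x\ge 0$ and suppose that $\overline\lambda\ge 0$ satisfies $\Psi_n'(\overline\lambda)=x\sigma$. Then there is a real number $\theta$ with $|\theta|\le 1$ such that $$\mathbf P(S_n>x\sigma)=\Big(\Theta\big(\overline\lambda\,\overline\sigma(\overline\lambda)\big)+\theta\,\varepsilon_x\Big)\inf_{\lambda\ge 0}\mathbf E e^{\lambda(S_n-x\sigma)},\qquad \varepsilon_x=\frac{2^{3+\delta}\,C_{2+\delta}\,e^{B\overline\lambda}}{\overline\sigma(\overline\lambda)^{2+\delta}}\sum_{i=1}^n\mathbf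 E|\xi_i|^{2+\delta}.$$ -/

import Mathlib

open MeasureTheory ProbabilityTheory

namespace SharpLD

universe u

/-- Standard normal distribution function `Φ`. -/
noncomputable def Phi (y : ℝ) : ℝ := cdf (gaussianReal 0 1) y

/-- `Θ(y) = (1 - Φ(y)) exp(y² / 2)`. -/
noncomputable def Theta (y : ℝ) : ℝ := (1 - Phi y) * Real.exp (y ^ 2 / 2)

section Sums

variable {Ω : Type u} [MeasurableSpace Ω] {n : ℕ}

/-- The standing assumptions on the summands: `ξ 0, …, ξ (n-1)` are independent, non-degenerate
(not almost surely constant), centered real random variables with finite absolute moments of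
order `2 + δ`. -/
structure IsCenteredFamily (P : Measure Ω) (δ : ℝ) (ξ : Fin n → Ω → ℝ) : Prop where
  measurable : ∀ i, Measurable (ξ i)
  indep : iIndepFun ξ P
  nondegenerate : ∀ i, ¬ ∃ c : ℝ, ξ i =ᵐ[P] fun _ => c
  moment : ∀ i, Integrable (fun ω => |ξ i ω| ^ (2 + δ)) P
  mean_zero : ∀ i, ∫ ω, ξ i ω ∂P = 0

/-- `S_n = ∑ ξ_i`. -/
def sumS (ξ : Fin n → Ω → ℝ) (ω : Ω) : ℝ := ∑ i, ξ i ω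

/-- `σ`, where `σ² = ∑ E ξ_i²`. -/
noncomputable def sigma (P : Measure Ω) (ξ : Fin n → Ω → ℝ) : ℝ :=
  Real.sqrt (∑ i, ∫ ω, ξ i ω ^ 2 ∂P)

/-- `∑ E |ξ_i|^(2+δ)`. -/
noncomputable def momentSum (P : Measure Ω) (δ : ℝ) (ξ : Fin n → Ω → ℝ) : ℝ :=
  ∑ i, ∫ ω, |ξ i ω| ^ (2 + δ) ∂P

/-- The cumulant function `Ψ_n(l) = ∑ log E exp(l ξ_i)`. -/
noncomputable def Psi (P : Measure Ω) (ξ : Fin n → Ω → ℝ) (l : ℝ) : ℝ :=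
  ∑ i, Real.log (∫ ω, Real.exp (l * ξ i ω) ∂P)

/-- The Esscher density `Z_n(l) = ∏ exp(l ξ_i) / E exp(l ξ_i)`. -/
noncomputable def esscherDensity (P : Measure Ω) (ξ : Fin n → Ω → ℝ) (l : ℝ) (ω : Ω) : ℝ :=
  ∏ i, Real.exp (l * ξ i ω) / ∫ ω', Real.exp (l * ξ i ω') ∂P

/-- The conjugate measure `P_l`, given by `dP_l = Z_n(l) dP`. -/
noncomputable def conjMeasure (P : Measure Ω) (ξ : Fin n → Ω → ℝ) (l : ℝ) : Measure Ω :=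
  P.withDensity fun ω => ENNReal.ofReal (esscherDensity P ξ l ω)

/-- `Y_n(l) = ∑ (ξ_i - E_l ξ_i)`. -/
noncomputable def conjCentered (P : Measure Ω) (ξ : Fin n → Ω → ℝ) (l : ℝ) (ω : Ω) : ℝ :=
  ∑ i, (ξ i ω - ∫ ω', ξ i ω' ∂(conjMeasure P ξ l))

/-- The standard deviation of `S_n` under the conjugate measure: the nonnegative square root of
`E_l Y_n(l)²`. -/
noncomputable def conjSigma (P : Measure Ω) (ξ : Fin n → Ω → ℝ) (l : ℝ) : ℝ :=
  Real.sqrt (∫ ω, conjCentered P ξ l ω ^ 2 ∂(conjMeasure P ξ l))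

end Sums

/-- `C` is an admissible absolute constant in the Berry-Esseen (Lyapunov) bound of order `2 + δ`:
the bound holds for every number `n ≥ 1` of summands, every probability space and every family
satisfying the standing assumptions. The bound only involves the joint law of the family, a
measure on `Fin n → ℝ`, so probability spaces in `Type` already give all cases. -/
def IsLyapunovBound (δ C : ℝ) : Prop :=
  ∀ (n : ℕ), 1 ≤ n → ∀ (Ω : Type) (_ : MeasurableSpace Ω) (P : Measure Ω),
    IsProbabilityMeasure P → ∀ ξ : Fin n → Ω → ℝ, IsCenteredFamily P δ ξ →
      ∀ y : ℝ, |P.real {ω | sumS ξ ω ≤ y * sigma P ξ} - Phi y| ≤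
        C * (momentSum P δ ξ / sigma P ξ ^ (2 + δ))

/-- The Lyapunov constant `C_{2+δ}`: the least admissible absolute constant, as a real number. -/
noncomputable def lyapunovConst (δ : ℝ) : ℝ := sInf {C : ℝ | IsLyapunovBound δ C}

/-- `ε_x = 2^(3+δ) C_{2+δ} exp(B l) / σ̄(l)^(2+δ) * ∑ E |ξ_i|^(2+δ)`, at `l = λ̄`. -/
noncomputable def epsX {Ω : Type u} [MeasurableSpace Ω] {n : ℕ} (P : Measure Ω) (δ B : ℝ)
    (ξ : Fin n → Ω → ℝ) (l : ℝ) : ℝ :=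
  (2 : ℝ) ^ (3 + δ) * lyapunovConst δ * Real.exp (B * l) / conjSigma P ξ l ^ (2 + δ) *
    momentSum P δ ξ

end SharpLD

/-!
Write `Y = S_n - xσ`. Under the conjugate measure `P_l` at `l = lbar` the summands are still
independent, each with its own tilted law (`map_conjMeasure`), and `Ψ_n'(l) = xσ` says that `Y` has
mean zero (`IsCenteredFamily.hasDerivWithinAt_Psi`). Changing measure back,
`P(Y > 0) = E_l[e^{-lY} 1_{Y > 0}] · E e^{lY}` (`measure_lt_sumS_eq`), and the last factor is the
infimum over all exponents, because `e^y ≥ 1 + y` and `E_l Y = 0` (`iInf_integral_exp_eq`).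

For a standard normal `N` one has `E[e^{-aN} 1_{N > 0}] = Θ(a)`. The layers of `e^{-au} 1_{u > 0}`
are intervals with left end point `0`, so the first factor differs from `Θ(l σ̄(l))` by at most twice
the Kolmogorov distance between `Y / σ̄(l)` under `P_l` and the normal law
(`abs_integral_exp_neg_sub_Theta_le`). The Lyapunov bound controls that distance. Centering costs
`2^(2+δ)` in the moments (`integral_abs_sub_mean_rpow_le`), and tilting costs `e^{Bl}`, since
`e^{lξ} ≤ e^{Bl}` and `E e^{lξ} ≥ 1` (`IsCenteredFamily.moment_conjMeasure`).

The constant `lyapunovConst` is defined as an infimum, which carries information only if some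
constant is admissible. This is the Berry-Esseen theorem with moments of order `2 + δ`
(`isLyapunovBound_const`), proved by Stein's method. The solution `f` of
`f'(w) = w f(w) + 1_{w ≤ z} - Φ(z)` is bounded, as are `w f(w)` and `f'`. For
`W = ∑ Xᵢ` of unit variance, `P(W ≤ z) - Φ(z) = E f'(W) - E W f(W)` is a sum of differences
`E Xᵢ² E f'(W) - E Xᵢ f(W)`. Each comes down to how much `E f'(Wᵢ + u)` varies with `u`, where
`Wᵢ` is the sum of the other summands (`abs_stein_summand_le`). The jump of `f'` at `z` costs the
probability that `Wᵢ` falls in a short interval, and this is bounded by a concentration inequality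
of Chen and Shao (`measure_sum_mem_Icc_le`). Estimating `min(1, |u|) ≤ |u|^δ` throughout keeps the
bound within moments of order `2 + δ`.
-/

namespace SharpLD

open Set Filter Topology

/-! ### The normal distribution function -/

lemma Phi_eq_real (y : ℝ) : Phi y = (gaussianReal 0 1).real (Iic y) := cdf_eq_real _ _

lemma Phi_mono : Monotone Phi := monotone_cdf _

lemma Phi_nonneg (y : ℝ) : 0 ≤ Phi y := cdf_nonneg _ _

lemma Phi_le_one (y : ℝ) : Phi y ≤ 1 := cdf_le_one _ _

lemma one_sub_Phi_eq_real (y : ℝ) : 1 - Phi y = (gaussianReal 0 1).real (Ioi y) := by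
  rw [Phi_eq_real, ← compl_Iic, probReal_compl_eq_one_sub measurableSet_Iic]

lemma one_sub_Phi_eq_integral (y : ℝ) :
    1 - Phi y = ∫ t in Ioi y, gaussianPDFReal 0 1 t := by
  rw [one_sub_Phi_eq_real, measureReal_def, gaussianReal_apply_eq_integral _ one_ne_zero,
    ENNReal.toReal_ofReal]
  exact integral_nonneg fun t => gaussianPDFReal_nonneg _ _ _

lemma gaussianReal_real_Ici (y : ℝ) : (gaussianReal 0 1).real (Ici y) = 1 - Phi y := by
  have := nullSingletonClass_gaussianReal (μ := 0) (v := 1) one_ne_zero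
  rw [one_sub_Phi_eq_real, measureReal_def, measureReal_def, measure_congr Ioi_ae_eq_Ici]

lemma Phi_neg (y : ℝ) : Phi (-y) = 1 - Phi y := by
  rw [← gaussianReal_real_Ici, Phi_eq_real]
  have h : (gaussianReal 0 1).map (fun x : ℝ => -x) = gaussianReal 0 1 := by
    rw [gaussianReal_map_neg]; simp
  conv_lhs => rw [← h]
  rw [map_measureReal_apply measurable_neg measurableSet_Iic]
  congr 1
  ext t
  simp

lemma continuous_gaussianPDFReal : Continuous (gaussianPDFReal 0 1) := by
  unfold gaussianPDFReal
  fun_prop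

lemma gaussianPDFReal_zero_one (w : ℝ) :
    gaussianPDFReal 0 1 w = (√(2 * Real.pi))⁻¹ * Real.exp (-(w ^ 2 / 2)) := by
  simp only [gaussianPDFReal, NNReal.coe_one, mul_one, sub_zero]
  congr 2
  ring

lemma hasDerivAt_Phi (w : ℝ) : HasDerivAt Phi (gaussianPDFReal 0 1 w) w := by
  have h : ∀ y, Phi y = Phi 0 + ∫ t in (0 : ℝ)..y, gaussianPDFReal 0 1 t := by
    intro y
    have h1 := one_sub_Phi_eq_integral y
    have h0 := one_sub_Phi_eq_integral 0
    have := intervalIntegral.integral_Ioi_sub_Ioi' (f := gaussianPDFReal 0 1) (a := 0) (b := y)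
      (μ := volume) (integrable_gaussianPDFReal 0 1).integrableOn
      (integrable_gaussianPDFReal 0 1).integrableOn
    linarith
  rw [funext h]
  exact (intervalIntegral.integral_hasDerivAt_right
    (continuous_gaussianPDFReal.intervalIntegrable _ _)
    continuous_gaussianPDFReal.stronglyMeasurable.stronglyMeasurableAtFilter
    continuous_gaussianPDFReal.continuousAt).const_add _

lemma continuous_Phi : Continuous Phi :=
  continuous_iff_continuousAt.2 fun w => (hasDerivAt_Phi w).continuousAt

/-- The Chernoff bound for the normal tail. -/
lemma Theta_le_one {y : ℝ} (hy : 0 ≤ y) : Theta y ≤ 1 := by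
  have h := measure_ge_le_exp_mul_mgf (μ := gaussianReal 0 1) (X := id) y hy
    (integrable_exp_mul_gaussianReal y)
  rw [mgf_id_gaussianReal] at h
  have h2 : (gaussianReal 0 1).real {ω : ℝ | y ≤ id ω} = 1 - Phi y := gaussianReal_real_Ici y
  rw [h2, ← Real.exp_add] at h
  unfold Theta
  calc (1 - Phi y) * Real.exp (y ^ 2 / 2) ≤
      Real.exp (-y * y + (0 * y + (1 : NNReal) * y ^ 2 / 2)) * Real.exp (y ^ 2 / 2) := by gcongr
    _ = 1 := by
      rw [← Real.exp_add, Real.exp_eq_one_iff]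
      push_cast
      ring

/-- Mills' inequality `y (1 - Φ(y)) ≤ φ(y)`. -/
lemma mul_Theta_le {y : ℝ} (hy : 0 ≤ y) : √(2 * Real.pi) * (y * Theta y) ≤ 1 := by
  have hd : ∀ t : ℝ, HasDerivAt (fun t => -gaussianPDFReal 0 1 t) (t * gaussianPDFReal 0 1 t) t := by
    intro t
    simp only [gaussianPDFReal_zero_one]
    have := ((((hasDerivAt_id t).pow 2).div_const 2).neg.exp.const_mul (√(2 * Real.pi))⁻¹).neg
    refine this.congr_deriv ?_
    simp
    ring
  have hlim : Tendsto (fun t => -gaussianPDFReal 0 1 t) atTop (𝓝 0) := by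
    have : Tendsto (fun t : ℝ => -((√(2 * Real.pi))⁻¹ * Real.exp (-(t ^ 2 / 2)))) atTop
        (𝓝 (-((√(2 * Real.pi))⁻¹ * 0))) := by
      refine Tendsto.neg (Tendsto.const_mul _ ?_)
      refine Real.tendsto_exp_neg_atTop_nhds_zero.comp ?_
      exact (tendsto_pow_atTop two_ne_zero).atTop_div_const two_pos
    simpa [gaussianPDFReal_zero_one] using this
  have hpos : ∀ t ∈ Ioi y, 0 ≤ t * gaussianPDFReal 0 1 t := fun t ht =>
    mul_nonneg (hy.trans (le_of_lt ht)) (gaussianPDFReal_nonneg _ _ _)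
  have hint := integrableOn_Ioi_deriv_of_nonneg' (fun t _ => hd t) hpos hlim
  have hval := integral_Ioi_of_hasDerivAt_of_nonneg' (fun t _ => hd t) hpos hlim
  have hle : y * (1 - Phi y) ≤ gaussianPDFReal 0 1 y := by
    rw [one_sub_Phi_eq_integral, ← integral_const_mul]
    calc ∫ t in Ioi y, y * gaussianPDFReal 0 1 t ≤ ∫ t in Ioi y, t * gaussianPDFReal 0 1 t := by
          refine setIntegral_mono_on ((integrable_gaussianPDFReal 0 1).integrableOn.const_mul y)
            hint measurableSet_Ioi fun t ht => ?_
          exact mul_le_mul_of_nonneg_right (le_of_lt ht) (gaussianPDFReal_nonneg _ _ _)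
      _ = gaussianPDFReal 0 1 y := by rw [hval]; ring
  unfold Theta
  calc √(2 * Real.pi) * (y * ((1 - Phi y) * Real.exp (y ^ 2 / 2)))
      = √(2 * Real.pi) * Real.exp (y ^ 2 / 2) * (y * (1 - Phi y)) := by ring
    _ ≤ √(2 * Real.pi) * Real.exp (y ^ 2 / 2) * gaussianPDFReal 0 1 y := by gcongr
    _ = (√(2 * Real.pi) * (√(2 * Real.pi))⁻¹) *
        (Real.exp (y ^ 2 / 2) * Real.exp (-(y ^ 2 / 2))) := by
      rw [gaussianPDFReal_zero_one]; ring
    _ = 1 := by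
      rw [← Real.exp_add, add_neg_cancel, Real.exp_zero, mul_one, mul_inv_cancel₀]
      positivity

/-! ### Stein's equation -/

/-- The bounded solution `f` of Stein's equation `f'(w) = w f(w) + 1_{w ≤ z} - Φ(z)`, in a form
that treats both sides of `z` at once. -/
noncomputable def steinSol (z w : ℝ) : ℝ :=
  √(2 * Real.pi) * Real.exp (w ^ 2 / 2) * (Phi (min w z) * (1 - Phi (max w z)))

/-- The right-hand side of Stein's equation; it is the derivative of `steinSol z` except at `z`,
where `steinSol z` has a corner. -/
noncomputable def steinDeriv (z w : ℝ) : ℝ :=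
  w * steinSol z w + (Iic z).indicator 1 w - Phi z

lemma steinSol_nonneg (z w : ℝ) : 0 ≤ steinSol z w := by
  unfold steinSol
  have h1 := Phi_nonneg (min w z)
  have h2 := Phi_le_one (max w z)
  have h3 : 0 ≤ 1 - Phi (max w z) := by linarith
  positivity

lemma steinSol_le (z w : ℝ) : steinSol z w ≤ √(2 * Real.pi) * Theta |w| := by
  have key : Phi (min w z) * (1 - Phi (max w z)) ≤ 1 - Phi |w| := by
    have h1 : Phi (min w z) ≤ Phi w := Phi_mono (min_le_left _ _)
    have h2 : Phi w ≤ Phi (max w z) := Phi_mono (le_max_left _ _)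
    have h3 := Phi_le_one (max w z)
    have h4 := Phi_nonneg (min w z)
    have h5 := Phi_le_one w
    have h6 : Phi (min w z) * (1 - Phi (max w z)) ≤ Phi w * (1 - Phi w) :=
      mul_le_mul h1 (by linarith) (by linarith) (h4.trans h1)
    rcases le_total 0 w with hw | hw
    · rw [abs_of_nonneg hw]
      nlinarith
    · rw [abs_of_nonpos hw, Phi_neg]
      nlinarith
  unfold steinSol Theta
  rw [sq_abs]
  calc _ ≤ √(2 * Real.pi) * Real.exp (w ^ 2 / 2) * (1 - Phi |w|) := by gcongr
    _ = _ := by ring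

lemma abs_mul_steinSol_le (z w : ℝ) : |w * steinSol z w| ≤ 1 := by
  rw [abs_mul, abs_of_nonneg (steinSol_nonneg z w)]
  calc |w| * steinSol z w ≤ |w| * (√(2 * Real.pi) * Theta |w|) := by
        gcongr; exact steinSol_le z w
    _ = √(2 * Real.pi) * (|w| * Theta |w|) := by ring
    _ ≤ 1 := mul_Theta_le (abs_nonneg w)

lemma abs_steinSol_le (z w : ℝ) : |steinSol z w| ≤ 3 := by
  rw [abs_of_nonneg (steinSol_nonneg z w)]
  have h : √(2 * Real.pi) ≤ 3 := by
    rw [Real.sqrt_le_left (by norm_num)]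
    nlinarith [Real.pi_lt_four]
  calc steinSol z w ≤ √(2 * Real.pi) * Theta |w| := steinSol_le z w
    _ ≤ √(2 * Real.pi) * 1 := by
      gcongr
      exact Theta_le_one (abs_nonneg w)
    _ ≤ 3 := by rwa [mul_one]

lemma abs_steinDeriv_le (z w : ℝ) : |steinDeriv z w| ≤ 2 := by
  have h1 := abs_le.1 (abs_mul_steinSol_le z w)
  have h2 := Phi_nonneg z
  have h3 := Phi_le_one z
  unfold steinDeriv
  by_cases hw : w ∈ Iic z
  · rw [indicator_of_mem hw, Pi.one_apply, abs_le]
    constructor <;> linarith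
  · rw [indicator_of_notMem hw, abs_le]
    constructor <;> linarith

lemma continuous_steinSol (z : ℝ) : Continuous (steinSol z) := by
  unfold steinSol
  have := continuous_Phi
  fun_prop

lemma measurable_steinDeriv (z : ℝ) : Measurable (steinDeriv z) := by
  unfold steinDeriv
  have := (continuous_steinSol z).measurable
  exact ((measurable_id.mul this).add (measurable_one.indicator measurableSet_Iic)).sub_const _

lemma hasDerivAt_steinSol {z w : ℝ} (hwz : w ≠ z) :
    HasDerivAt (steinSol z) (steinDeriv z w) w := by
  have hexp : HasDerivAt (fun w : ℝ => √(2 * Real.pi) * Real.exp (w ^ 2 / 2))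
      (√(2 * Real.pi) * (Real.exp (w ^ 2 / 2) * w)) w := by
    have := (((hasDerivAt_id w).pow 2).div_const 2).exp.const_mul (√(2 * Real.pi))
    refine this.congr_deriv ?_
    simp
  have hcancel : √(2 * Real.pi) * Real.exp (w ^ 2 / 2) * gaussianPDFReal 0 1 w = 1 := by
    rw [gaussianPDFReal_zero_one]
    calc _ = (√(2 * Real.pi) * (√(2 * Real.pi))⁻¹) *
        (Real.exp (w ^ 2 / 2) * Real.exp (-(w ^ 2 / 2))) := by ring
      _ = 1 := by
        rw [← Real.exp_add, add_neg_cancel, Real.exp_zero, mul_one, mul_inv_cancel₀]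
        positivity
  rcases lt_or_gt_of_ne hwz with h | h
  · have heq : steinSol z =ᶠ[𝓝 w]
        fun w => √(2 * Real.pi) * Real.exp (w ^ 2 / 2) * (Phi w * (1 - Phi z)) := by
      filter_upwards [Iio_mem_nhds h] with v hv
      rw [steinSol, min_eq_left (le_of_lt hv), max_eq_right (le_of_lt hv)]
    refine HasDerivAt.congr_of_eventuallyEq ?_ heq
    have hd := hexp.mul ((hasDerivAt_Phi w).mul_const (1 - Phi z))
    refine hd.congr_deriv ?_
    rw [steinDeriv.eq_def, indicator_of_mem (show w ∈ Iic z from le_of_lt h), heq.eq_of_nhds,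
      Pi.one_apply]
    linear_combination (1 - Phi z) * hcancel
  · have heq : steinSol z =ᶠ[𝓝 w]
        fun w => √(2 * Real.pi) * Real.exp (w ^ 2 / 2) * (Phi z * (1 - Phi w)) := by
      filter_upwards [Ioi_mem_nhds h] with v hv
      rw [steinSol, min_eq_right (le_of_lt hv), max_eq_left (le_of_lt hv)]
    refine HasDerivAt.congr_of_eventuallyEq ?_ heq
    have hd := hexp.mul (((hasDerivAt_Phi w).const_sub 1).const_mul (Phi z))
    refine hd.congr_deriv ?_
    rw [steinDeriv.eq_def, indicator_of_notMem (show w ∉ Iic z from not_le.2 h), heq.eq_of_nhds]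
    linear_combination -(Phi z * hcancel)

lemma intervalIntegrable_steinDeriv (z w a b : ℝ) :
    IntervalIntegrable (fun t => steinDeriv z (w + t)) volume a b := by
  refine (intervalIntegrable_const (c := (2 : ℝ))).mono_fun
    ((measurable_steinDeriv z).comp (measurable_const_add w)).aestronglyMeasurable ?_
  exact Eventually.of_forall fun t => by simpa using abs_steinDeriv_le z (w + t)

lemma steinSol_sub_steinSol (z w u : ℝ) :
    steinSol z (w + u) - steinSol z w = ∫ t in (0 : ℝ)..u, steinDeriv z (w + t) := by
  have h := MeasureTheory.integral_eq_of_hasDerivAt_off_countable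
    (fun t => steinSol z (w + t)) (fun t => steinDeriv z (w + t)) (a := 0) (b := u)
    (countable_singleton (z - w)) ((continuous_steinSol z).comp (by fun_prop)).continuousOn
    (fun t ht => ?_) (intervalIntegrable_steinDeriv z w 0 u)
  · rw [h, add_zero]
  · refine HasDerivAt.comp_const_add w t (hasDerivAt_steinSol ?_)
    intro h
    exact ht.2 (by rw [mem_singleton_iff, ← h]; ring)

lemma abs_steinSol_sub_le (z w u : ℝ) : |steinSol z (w + u) - steinSol z w| ≤ 2 * |u| := by
  rw [steinSol_sub_steinSol]
  have := intervalIntegral.norm_integral_le_of_norm_le_const (a := 0) (b := u)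
    (f := fun t => steinDeriv z (w + t)) (C := 2) (fun t _ => abs_steinDeriv_le z (w + t))
  simpa using this

/-- The continuous part of `steinDeriv` is Hölder continuous of every order `δ ≤ 1`, with a constant
growing linearly in the base point. -/
lemma abs_mul_steinSol_sub_le {δ : ℝ} (hδ : δ ∈ Ioc (0 : ℝ) 1) (z w u : ℝ) :
    |(w + u) * steinSol z (w + u) - w * steinSol z w| ≤ (2 * |w| + 3) * |u| ^ δ := by
  rcases le_total |u| 1 with hu | hu
  · have h1 : |u| ≤ |u| ^ δ := by
      conv_lhs => rw [← Real.rpow_one |u|]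
      exact Real.rpow_le_rpow_of_exponent_ge_of_imp (abs_nonneg u) hu hδ.2 (by
        intro _ h; exact absurd h one_ne_zero)
    calc |(w + u) * steinSol z (w + u) - w * steinSol z w|
        = |w * (steinSol z (w + u) - steinSol z w) + u * steinSol z (w + u)| := by ring_nf
      _ ≤ |w| * |steinSol z (w + u) - steinSol z w| + |u| * |steinSol z (w + u)| := by
        rw [← abs_mul, ← abs_mul]; exact abs_add_le _ _
      _ ≤ |w| * (2 * |u|) + |u| * 3 := by
        gcongr
        · exact abs_steinSol_sub_le z w u
        · exact abs_steinSol_le z _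
      _ = (2 * |w| + 3) * |u| := by ring
      _ ≤ _ := by gcongr
  · have h1 : 1 ≤ |u| ^ δ := Real.one_le_rpow hu hδ.1.le
    have h2 := abs_le.1 (abs_mul_steinSol_le z w)
    have h3 := abs_le.1 (abs_mul_steinSol_le z (w + u))
    have h4 : |(w + u) * steinSol z (w + u) - w * steinSol z w| ≤ 2 := by
      rw [abs_le]; constructor <;> linarith
    nlinarith [abs_nonneg w]

/-! ### Moments of sums of independent centered variables -/

section Sums

variable {Ω ι : Type*} [MeasurableSpace Ω] {P : Measure Ω} [IsProbabilityMeasure P]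
  {X : ι → Ω → ℝ} {s : Finset ι}

lemma integral_sq_sum (hind : iIndepFun X P) (hL : ∀ i, MemLp (X i) 2 P)
    (h0 : ∀ i, ∫ ω, X i ω ∂P = 0) :
    ∫ ω, (∑ i ∈ s, X i ω) ^ 2 ∂P = ∑ i ∈ s, ∫ ω, X i ω ^ 2 ∂P := by
  have h := IndepFun.variance_sum (s := s) (fun i _ => hL i) fun i _ j _ hij => hind.indepFun hij
  have hi : ∀ i, Var[X i; P] = ∫ ω, X i ω ^ 2 ∂P := fun i =>
    variance_of_integral_eq_zero (hL i).aemeasurable (h0 i)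
  have hS : ∫ ω, (∑ i ∈ s, X i) ω ∂P = 0 := by
    simp only [Finset.sum_apply]
    rw [integral_finsetSum _ fun i _ => (hL i).integrable one_le_two]
    exact Finset.sum_eq_zero fun i _ => h0 i
  rw [variance_of_integral_eq_zero (memLp_finsetSum' s fun i _ => hL i).aemeasurable hS] at h
  simpa [hi] using h

omit [IsProbabilityMeasure P] in
lemma indepFun_sum_erase [DecidableEq ι] (hind : iIndepFun X P) (hm : ∀ i, Measurable (X i))
    (i : ι) : IndepFun (fun ω => ∑ j ∈ s.erase i, X j ω) (X i) P := by
  have := hind.indepFun_finsetSum_of_notMem hm (Finset.notMem_erase i s)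
  convert this using 1
  ext ω
  simp

omit [IsProbabilityMeasure P] in
/-- If `X i` is centered, a bounded function of the remaining summands is uncorrelated with it. -/
lemma integral_mul_comp_sum_erase [DecidableEq ι] (hind : iIndepFun X P)
    (hm : ∀ i, Measurable (X i)) (h0 : ∀ i, ∫ ω, X i ω ∂P = 0) (i : ι) {f : ℝ → ℝ}
    (hf : Measurable f) : ∫ ω, X i ω * f (∑ j ∈ s.erase i, X j ω) ∂P = 0 := by
  have h := (indepFun_sum_erase (s := s) hind hm i).symm.comp measurable_id hf
  have h2 := h.integral_mul_eq_mul_integral (hm i).aestronglyMeasurable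
    (hf.comp (Finset.measurable_sum _ fun j _ => hm j)).aestronglyMeasurable
  simp only [Function.id_comp, h0 i, zero_mul] at h2
  exact h2

/-! ### A concentration inequality -/

/-- The truncation of `w - m` to `[-L, L]`. -/
def clamp (m L w : ℝ) : ℝ := max (-L) (min (w - m) L)

lemma abs_clamp_le {L : ℝ} (hL : 0 ≤ L) (m w : ℝ) : |clamp m L w| ≤ L := by
  unfold clamp
  rw [abs_le]
  exact ⟨le_max_left _ _, max_le (by linarith) (min_le_right _ _)⟩

lemma continuous_clamp (m L : ℝ) : Continuous (clamp m L) := by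
  unfold clamp
  fun_prop

lemma clamp_mono (m L : ℝ) : Monotone (clamp m L) := fun x y h => by
  unfold clamp
  gcongr

lemma mul_clamp_sub_nonneg (m L w x : ℝ) : 0 ≤ x * (clamp m L w - clamp m L (w - x)) := by
  rcases le_total 0 x with hx | hx
  · exact mul_nonneg hx (sub_nonneg.2 (clamp_mono m L (by linarith)))
  · exact mul_nonneg_of_nonpos_of_nonpos hx (sub_nonpos.2 (clamp_mono m L (by linarith)))

/-- The clamp has slope one within distance `α` of `[a, b]`. -/
lemma abs_mul_min_le_mul_clamp_sub {a b α w : ℝ} (hα : 0 ≤ α) (hw : w ∈ Icc a b) (x : ℝ) :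
    |x| * min |x| α ≤ x * (clamp ((a + b) / 2) ((b - a) / 2 + α) w -
      clamp ((a + b) / 2) ((b - a) / 2 + α) (w - x)) := by
  obtain ⟨h1, h2⟩ := hw
  have hcw : clamp ((a + b) / 2) ((b - a) / 2 + α) w = w - (a + b) / 2 := by
    rw [clamp, min_eq_left (by linarith), max_eq_right (by linarith)]
  rw [hcw]
  rcases le_total 0 x with hx | hx
  · rw [abs_of_nonneg hx]
    gcongr
    rw [clamp, le_sub_comm]
    refine max_le ?_ ((min_le_left _ _).trans ?_)
    · linarith [min_le_right x α]
    · linarith [min_le_left x α]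
  · rw [abs_of_nonpos hx, ← neg_mul_neg x]
    have : 0 ≤ -x := by linarith
    gcongr
    rw [clamp, max_eq_right (le_min (by linarith) (by linarith))]
    have h : min (-x) α + (w - (a + b) / 2) ≤ min (w - x - (a + b) / 2) ((b - a) / 2 + α) :=
      le_min (by linarith [min_le_left (-x) α]) (by linarith [min_le_right (-x) α])
    linarith

/-- Chen and Shao's concentration inequality: a sum of independent centered variables of total
variance at most one, with enough of that variance carried by values of size at most `α`, puts mass
at most `(b - a) + 4 α` on `[a, b]`. It follows from comparing the two sides of
`E W f(W) = ∑ E Xᵢ (f(W) - f(W - Xᵢ))`, where `f` is the clamp adapted to `[a, b]`. -/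
lemma measure_sum_mem_Icc_le (hind : iIndepFun X P) (hm : ∀ i, Measurable (X i))
    (hL : ∀ i, MemLp (X i) 2 P) (h0 : ∀ i, ∫ ω, X i ω ∂P = 0) {α : ℝ} (hα : 0 < α)
    (hvar : ∑ i ∈ s, ∫ ω, X i ω ^ 2 ∂P ≤ 1)
    (htrunc : 1 / 2 ≤ ∑ i ∈ s, ∫ ω, |X i ω| * min |X i ω| α ∂P) {a b : ℝ} (hab : a ≤ b) :
    P.real {ω | ∑ i ∈ s, X i ω ∈ Icc a b} ≤ (b - a) + 4 * α := by
  classical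
  set W : Ω → ℝ := fun ω => ∑ i ∈ s, X i ω with hW
  set L : ℝ := (b - a) / 2 + α with hLdef
  set f : ℝ → ℝ := clamp ((a + b) / 2) L with hf
  set A : Set Ω := {ω | W ω ∈ Icc a b} with hA
  have hLpos : 0 ≤ L := by rw [hLdef]; linarith
  have hWm : Measurable W := Finset.measurable_sum _ fun j _ => hm j
  have hfm : Measurable f := (continuous_clamp _ _).measurable
  have hAm : MeasurableSet A := hWm measurableSet_Icc
  have hW2 : MemLp W 2 P := memLp_finsetSum s fun i _ => hL i
  have hfb : ∀ w, |f w| ≤ L := abs_clamp_le hLpos _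
  have hXi : ∀ i, Integrable (X i) P := fun i => (hL i).integrable one_le_two
  have hXsq : ∀ i, Integrable (fun ω => X i ω ^ 2) P := fun i => (hL i).integrable_sq
  have hXf : ∀ i (g : Ω → ℝ), Measurable g → Integrable (fun ω => X i ω * f (g ω)) P :=
    fun i g hg => (hXi i).mul_bdd (c := L) (hfm.comp hg).aestronglyMeasurable
      (Eventually.of_forall fun ω => hfb _)
  -- the truncated second moments `η`
  set e : ι → Ω → ℝ := fun i ω => |X i ω| * min |X i ω| α with he
  have hem : ∀ i, Measurable (e i) := fun i => by
    have := hm i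
    simp only [he]
    fun_prop
  have he0 : ∀ i ω, 0 ≤ e i ω := fun i ω => mul_nonneg (abs_nonneg _) (le_min (abs_nonneg _) hα.le)
  have heX : ∀ i ω, e i ω ≤ α * |X i ω| := fun i ω => by
    rw [mul_comm α]
    exact mul_le_mul_of_nonneg_left (min_le_right _ _) (abs_nonneg _)
  have heL : ∀ i, MemLp (e i) 2 P := fun i =>
    ((hL i).norm.const_mul α).mono (hem i).aestronglyMeasurable (Eventually.of_forall fun ω => by
      rw [Real.norm_of_nonneg (he0 i ω)]
      exact (heX i ω).trans (le_abs_self _))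
  have hei : ∀ i, Integrable (e i) P := fun i => (heL i).integrable one_le_two
  set η : Ω → ℝ := fun ω => ∑ i ∈ s, e i ω with hη
  have hηL : MemLp η 2 P := memLp_finsetSum s fun i _ => heL i
  have hηi : Integrable η P := hηL.integrable one_le_two
  set M : ℝ := ∫ ω, η ω ∂P with hM
  have hMhalf : 1 / 2 ≤ M := by
    rw [hM, hη, integral_finsetSum _ fun i _ => hei i]
    exact htrunc
  have hvarη : ∫ ω, (η ω - M) ^ 2 ∂P ≤ α ^ 2 := by
    have h1 := variance_eq_integral (X := η) hηL.aemeasurable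
    have h2 := IndepFun.variance_sum (s := s) (X := e) (fun i _ => heL i) fun i _ j _ hij =>
      (hind.indepFun hij).comp (φ := fun x : ℝ => |x| * min |x| α)
        (ψ := fun x : ℝ => |x| * min |x| α) (by fun_prop) (by fun_prop)
    have h3 : (∑ i ∈ s, e i) = η := by ext ω; simp [hη]
    rw [h3, h1] at h2
    rw [h2]
    calc ∑ i ∈ s, Var[e i; P] ≤ ∑ i ∈ s, α ^ 2 * ∫ ω, X i ω ^ 2 ∂P := by
          refine Finset.sum_le_sum fun i _ => ?_
          rw [← integral_const_mul]
          refine (variance_le_expectation_sq (hem i).aestronglyMeasurable).trans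
            (integral_mono (heL i).integrable_sq ((hXsq i).const_mul _) fun ω => ?_)
          have := pow_le_pow_left₀ (he0 i ω) (heX i ω) 2
          rwa [mul_pow α, sq_abs] at this
      _ ≤ α ^ 2 * 1 := by
          rw [← Finset.mul_sum]
          gcongr
      _ = α ^ 2 := mul_one _
  have hdev2 : Integrable (fun ω => (η ω - M) ^ 2) P := (hηL.sub (memLp_const M)).integrable_sq
  have hdevi : Integrable (fun ω => |η ω - M|) P := (hηi.sub (integrable_const M)).abs
  have hdev : ∫ ω, |η ω - M| ∂P ≤ α := by
    calc ∫ ω, |η ω - M| ∂P ≤ ∫ ω, ((2 * α)⁻¹ * (η ω - M) ^ 2 + α / 2) ∂P := by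
          refine integral_mono hdevi
            ((hdev2.const_mul _).add (integrable_const _)) fun ω => ?_
          have h1 := sq_nonneg (|η ω - M| - α)
          have h2 : (2 * α)⁻¹ * (η ω - M) ^ 2 + α / 2 - |η ω - M| =
              (2 * α)⁻¹ * (|η ω - M| - α) ^ 2 := by
            rw [sub_sq (|η ω - M|), sq_abs]
            field_simp
            ring
          have h3 : 0 ≤ (2 * α)⁻¹ * (|η ω - M| - α) ^ 2 := by positivity
          simp only
          linarith
      _ = (2 * α)⁻¹ * ∫ ω, (η ω - M) ^ 2 ∂P + α / 2 := by
          rw [integral_add (hdev2.const_mul _) (integrable_const _), integral_const_mul]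
          simp
      _ ≤ (2 * α)⁻¹ * α ^ 2 + α / 2 := by gcongr
      _ = α := by field_simp; ring
  -- upper bound for `E W f(W)`
  have hWsq : ∫ ω, W ω ^ 2 ∂P ≤ 1 := by
    rw [hW, integral_sq_sum hind hL h0]
    exact hvar
  have hup : ∫ ω, W ω * f (W ω) ∂P ≤ L := by
    calc ∫ ω, W ω * f (W ω) ∂P ≤ ∫ ω, L * ((W ω ^ 2 + 1) / 2) ∂P := by
          refine integral_mono ?_ (((hW2.integrable_sq.add (integrable_const 1)).div_const 2).const_mul
            L) fun ω => ?_
          · exact (hW2.integrable one_le_two).mul_bdd (c := L) (hfm.comp hWm).aestronglyMeasurable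
              (Eventually.of_forall fun ω => hfb _)
          · calc W ω * f (W ω) ≤ |W ω| * |f (W ω)| := by
                  rw [← abs_mul]; exact le_abs_self _
              _ ≤ |W ω| * L := by gcongr; exact hfb _
              _ = L * |W ω| := mul_comm _ _
              _ ≤ L * ((W ω ^ 2 + 1) / 2) := by
                  gcongr
                  nlinarith [sq_nonneg (|W ω| - 1), sq_abs (W ω)]
      _ = L * ((∫ ω, W ω ^ 2 ∂P + 1) / 2) := by
          rw [integral_const_mul, integral_div,
            integral_add hW2.integrable_sq (integrable_const 1)]
          simp
      _ ≤ L * ((1 + 1) / 2) := by gcongr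
      _ = L := by ring
  -- lower bound for `E W f(W)`
  have hdecomp : ∫ ω, W ω * f (W ω) ∂P =
      ∫ ω, ∑ i ∈ s, X i ω * (f (W ω) - f (W ω - X i ω)) ∂P := by
    have hpt : ∀ ω, W ω * f (W ω) = ∑ i ∈ s, X i ω * f (W ω) := fun ω => by
      rw [hW, Finset.sum_mul]
    simp only [hpt, mul_sub]
    have hXfs : ∀ i, Integrable (fun ω => X i ω * f (W ω - X i ω)) P := fun i =>
      hXf i _ (hWm.sub (hm i))
    rw [integral_finsetSum _ fun i _ => hXf i W hWm, integral_finsetSum]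
    swap
    · exact fun i _ => (hXf i W hWm).sub (hXfs i)
    refine Finset.sum_congr rfl fun i hi => ?_
    rw [integral_sub (hXf i W hWm) (hXfs i)]
    have : ∀ ω, W ω - X i ω = ∑ j ∈ s.erase i, X j ω := fun ω => by
      rw [hW, Finset.sum_erase_eq_sub hi]
    simp only [this]
    rw [integral_mul_comp_sum_erase hind hm h0 i hfm, sub_zero]
  have hlow : M * P.real A - α ≤ ∫ ω, W ω * f (W ω) ∂P := by
    have hind1 : ∫ ω, (A.indicator (fun _ => M) ω - |η ω - M|) ∂P =
        M * P.real A - ∫ ω, |η ω - M| ∂P := by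
      rw [integral_sub ((integrable_const M).indicator hAm) hdevi,
        integral_indicator_const _ hAm, smul_eq_mul, mul_comm]
    calc M * P.real A - α ≤ ∫ ω, (A.indicator (fun _ => M) ω - |η ω - M|) ∂P := by
          rw [hind1]; linarith
      _ ≤ ∫ ω, ∑ i ∈ s, X i ω * (f (W ω) - f (W ω - X i ω)) ∂P := by
          refine integral_mono
            (((integrable_const M).indicator hAm).sub hdevi)
            (integrable_finsetSum _ fun i _ => ?_) fun ω => ?_
          · simp only [mul_sub]
            exact (hXf i W hWm).sub (hXf i _ (hWm.sub (hm i)))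
          · by_cases hω : ω ∈ A
            · simp only [indicator_of_mem hω]
              calc M - |η ω - M| ≤ η ω := by linarith [neg_abs_le (η ω - M)]
                _ ≤ _ := Finset.sum_le_sum fun i _ => abs_mul_min_le_mul_clamp_sub hα.le hω _
            · simp only [indicator_of_notMem hω]
              have h1 : 0 ≤ ∑ i ∈ s, X i ω * (f (W ω) - f (W ω - X i ω)) :=
                Finset.sum_nonneg fun i _ => mul_clamp_sub_nonneg _ _ _ _
              linarith [abs_nonneg (η ω - M)]
      _ = _ := hdecomp.symm
  have hA0 : 0 ≤ P.real A := measureReal_nonneg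
  have : 1 / 2 * P.real A ≤ M * P.real A := by gcongr
  rw [hLdef] at hup
  linarith

end Sums

/-! ### Elementary moment inequalities -/

lemma rpow_two_add {δ : ℝ} (hδ : 0 ≤ δ) (x : ℝ) : |x| ^ (2 + δ) = x ^ 2 * |x| ^ δ := by
  rw [Real.rpow_add_of_nonneg (abs_nonneg x) zero_le_two hδ, Real.rpow_two, sq_abs]

/-- The part of `x²` not captured by truncating one factor at level `t` is controlled by the moment
of order `2 + δ`. -/
lemma sq_le_mul_min_add {δ t : ℝ} (hδ : δ ∈ Ioc (0 : ℝ) 1) (ht : 0 < t) (ht1 : t ≤ 1) (x : ℝ) :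
    x ^ 2 ≤ |x| * min |x| t + |x| ^ (2 + δ) / t := by
  have h0 : 0 ≤ |x| ^ (2 + δ) / t := by positivity
  rcases le_total |x| t with h | h
  · rw [min_eq_left h, ← sq, sq_abs]
    linarith
  · have h1 : t ≤ |x| ^ δ := by
      calc t = t ^ (1 : ℝ) := (Real.rpow_one t).symm
        _ ≤ t ^ δ := Real.rpow_le_rpow_of_exponent_ge ht ht1 hδ.2
        _ ≤ |x| ^ δ := Real.rpow_le_rpow ht.le h hδ.1.le
    have h2 : x ^ 2 ≤ |x| ^ (2 + δ) / t := by
      rw [le_div_iff₀ ht, rpow_two_add hδ.1.le]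
      gcongr
    have h3 : 0 ≤ |x| * min |x| t := by positivity
    linarith

lemma sq_le_sq_add {δ t : ℝ} (hδ : δ ∈ Ioc (0 : ℝ) 1) (ht : 0 < t) (ht1 : t ≤ 1) (x : ℝ) :
    x ^ 2 ≤ t ^ 2 + 2 * |x| ^ (2 + δ) / t := by
  have h1 := sq_le_mul_min_add hδ ht ht1 x
  have h2 : |x| * min |x| t ≤ |x| * t := by gcongr; exact min_le_right _ _
  have h3 := sq_nonneg (|x| - t)
  have h4 := sq_abs x
  have h5 : 2 * |x| ^ (2 + δ) / t = 2 * (|x| ^ (2 + δ) / t) := by ring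
  rw [h5]
  nlinarith

lemma sq_mul_rpow_le {δ : ℝ} (hδ : 0 < δ) (x y : ℝ) :
    x ^ 2 * |y| ^ δ ≤ |x| ^ (2 + δ) + |y| ^ (2 + δ) := by
  have h1 : 0 ≤ |x| ^ (2 + δ) := by positivity
  have h2 : 0 ≤ |y| ^ (2 + δ) := by positivity
  rcases le_total |x| |y| with h | h
  · have : x ^ 2 * |y| ^ δ ≤ |y| ^ (2 + δ) := by
      rw [rpow_two_add hδ.le]
      exact mul_le_mul_of_nonneg_right (sq_le_sq.2 h) (by positivity)
    linarith
  · have : x ^ 2 * |y| ^ δ ≤ |x| ^ (2 + δ) := by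
      rw [rpow_two_add hδ.le]
      gcongr
    linarith

section Moments

variable {Ω : Type*} [MeasurableSpace Ω] {P : Measure Ω} [IsProbabilityMeasure P]
  {V Y : Ω → ℝ} {δ : ℝ}

lemma memLp_two_of_moment (hδ : δ ∈ Ioc (0 : ℝ) 1) (hY : Measurable Y)
    (hint : Integrable (fun ω => |Y ω| ^ (2 + δ)) P) : MemLp Y 2 P := by
  rw [memLp_two_iff_integrable_sq hY.aestronglyMeasurable]
  refine ((integrable_const (1 ^ 2)).add ((hint.const_mul 2).div_const 1)).mono'
    (hY.pow_const 2).aestronglyMeasurable (Eventually.of_forall fun ω => ?_)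
  rw [Real.norm_of_nonneg (sq_nonneg _)]
  exact sq_le_sq_add hδ one_pos le_rfl (Y ω)

lemma integrable_rpow_of_moment (hδ : δ ∈ Ioc (0 : ℝ) 1) (hY : Measurable Y)
    (hint : Integrable (fun ω => |Y ω| ^ (2 + δ)) P) : Integrable (fun ω => |Y ω| ^ δ) P := by
  refine ((integrable_const 1).add hint).mono' (hY.norm.pow_const δ).aestronglyMeasurable
    (Eventually.of_forall fun ω => ?_)
  have h : 0 ≤ |Y ω| ^ δ := by positivity
  rw [Real.norm_of_nonneg h]
  have := sq_mul_rpow_le hδ.1 1 (Y ω)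
  simpa using this

lemma sq_moment_mul_le (hδ : δ ∈ Ioc (0 : ℝ) 1) (hY : Measurable Y)
    (hint : Integrable (fun ω => |Y ω| ^ (2 + δ)) P) :
    (∫ ω, Y ω ^ 2 ∂P) * ∫ ω, |Y ω| ^ δ ∂P ≤ 2 * ∫ ω, |Y ω| ^ (2 + δ) ∂P := by
  have hδi := integrable_rpow_of_moment hδ hY hint
  have hsq := (memLp_two_of_moment hδ hY hint).integrable_sq
  rw [← integral_mul_const]
  calc ∫ ω, Y ω ^ 2 * ∫ ω', |Y ω'| ^ δ ∂P ∂P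
      ≤ ∫ ω, (|Y ω| ^ (2 + δ) + ∫ ω', |Y ω'| ^ (2 + δ) ∂P) ∂P := by
        refine integral_mono (hsq.mul_const _) (hint.add (integrable_const _)) fun ω => ?_
        simp only
        rw [← integral_const_mul]
        calc ∫ ω', Y ω ^ 2 * |Y ω'| ^ δ ∂P ≤ ∫ ω', (|Y ω| ^ (2 + δ) + |Y ω'| ^ (2 + δ)) ∂P :=
              integral_mono (hδi.const_mul _) ((integrable_const _).add hint) fun ω' =>
                sq_mul_rpow_le hδ.1 _ _
          _ = _ := by
              rw [integral_add (integrable_const _) hint]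
              simp
    _ = 2 * ∫ ω, |Y ω| ^ (2 + δ) ∂P := by
        rw [integral_add hint (integrable_const _)]
        simp
        ring

omit [IsProbabilityMeasure P] in
/-- Freezing one of two independent variables. -/
lemma integral_comp_indep [IsFiniteMeasure P] (hVY : IndepFun V Y P) (hV : Measurable V)
    (hY : Measurable Y) {F : ℝ × ℝ → ℝ} (hF : Measurable F)
    (hint : Integrable (fun ω => F (V ω, Y ω)) P) :
    ∫ ω, F (V ω, Y ω) ∂P = ∫ ω', ∫ ω, F (V ω, Y ω') ∂P ∂P := by
  have hmap := hVY.map_prod_eq_prod_map_map hV.aemeasurable hY.aemeasurable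
  have hVYm : Measurable fun ω => (V ω, Y ω) := hV.prodMk hY
  have h1 : ∫ ω, F (V ω, Y ω) ∂P = ∫ p, F p ∂((P.map V).prod (P.map Y)) := by
    rw [← hmap, integral_map hVYm.aemeasurable hF.aestronglyMeasurable]
  have hint2 : Integrable F ((P.map V).prod (P.map Y)) := by
    rw [← hmap, integrable_map_measure hF.aestronglyMeasurable hVYm.aemeasurable]
    exact hint
  rw [h1, integral_prod_symm F hint2, integral_map hY.aemeasurable
    hF.stronglyMeasurable.integral_prod_left'.aestronglyMeasurable]
  refine integral_congr_ae (Eventually.of_forall fun ω' => ?_)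
  exact integral_map hV.aemeasurable
    (hF.comp measurable_prodMk_right).aestronglyMeasurable

/-! ### Stein's method -/

/-- The shifted expectation `E f'(V + u)` of the Stein derivative. -/
noncomputable def steinShift (P : Measure Ω) (V : Ω → ℝ) (z u : ℝ) : ℝ :=
  ∫ ω, steinDeriv z (V ω + u) ∂P

lemma integrable_steinDeriv_comp {g : Ω → ℝ} (hg : Measurable g) (z : ℝ) :
    Integrable (fun ω => steinDeriv z (g ω)) P :=
  Integrable.of_bound ((measurable_steinDeriv z).comp hg).aestronglyMeasurable 2
    (Eventually.of_forall fun _ => abs_steinDeriv_le _ _)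

lemma integrable_steinSol_comp {g : Ω → ℝ} (hg : Measurable g) (z : ℝ) :
    Integrable (fun ω => steinSol z (g ω)) P :=
  Integrable.of_bound ((continuous_steinSol z).measurable.comp hg).aestronglyMeasurable 3
    (Eventually.of_forall fun _ => abs_steinSol_le _ _)

lemma integrable_mul_steinSol_comp {g : Ω → ℝ} (hg : Measurable g) (z : ℝ) :
    Integrable (fun ω => g ω * steinSol z (g ω)) P :=
  Integrable.of_bound (hg.mul ((continuous_steinSol z).measurable.comp hg)).aestronglyMeasurable 1
    (Eventually.of_forall fun _ => abs_mul_steinSol_le _ _)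

lemma abs_steinShift_le (V : Ω → ℝ) (z u : ℝ) : |steinShift P V z u| ≤ 2 := by
  unfold steinShift
  have := norm_integral_le_of_norm_le_const (μ := P) (f := fun ω => steinDeriv z (V ω + u)) (C := 2)
    (Eventually.of_forall fun _ => abs_steinDeriv_le _ _)
  simpa using this

lemma measurable_steinShift (hV : Measurable V) (z : ℝ) : Measurable (steinShift P V z) := by
  have : Measurable fun p : ℝ × Ω => steinDeriv z (V p.2 + p.1) :=
    (measurable_steinDeriv z).comp (by fun_prop)
  exact this.stronglyMeasurable.integral_prod_right'.measurable

/-- For a variable with a concentration property, `u ↦ E f'(V + u)` is Hölder continuous at `0` up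
to the concentration error: the jump of `f'` costs the probability of a window of width `2 |u|`. -/
lemma abs_steinShift_sub_le (hδ : δ ∈ Ioc (0 : ℝ) 1) (hV : Measurable V) (hV2 : MemLp V 2 P)
    (hVsq : ∫ ω, V ω ^ 2 ∂P ≤ 1) {γ : ℝ} (hγ : 0 ≤ γ)
    (hconc : ∀ a b, a ≤ b → P.real {ω | V ω ∈ Icc a b} ≤ (b - a) + γ) (z u : ℝ) :
    |steinShift P V z u - steinShift P V z 0| ≤ 7 * |u| ^ δ + γ := by
  set A : Set Ω := {ω | V ω ∈ Icc (z - |u|) (z + |u|)} with hA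
  have hAm : MeasurableSet A := hV measurableSet_Icc
  have hVi : Integrable (fun ω => |V ω|) P := (hV2.integrable one_le_two).abs
  have hVabs : ∫ ω, |V ω| ∂P ≤ 1 := by
    calc ∫ ω, |V ω| ∂P ≤ ∫ ω, (V ω ^ 2 + 1) / 2 ∂P := by
          refine integral_mono hVi ((hV2.integrable_sq.add (integrable_const 1)).div_const 2)
            fun ω => ?_
          simp only
          nlinarith [sq_nonneg (|V ω| - 1), sq_abs (V ω)]
      _ = (∫ ω, V ω ^ 2 ∂P + 1) / 2 := by
          rw [integral_div, integral_add hV2.integrable_sq (integrable_const 1)]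
          simp
      _ ≤ 1 := by linarith
  have hPA : P.real A ≤ 2 * |u| ^ δ + γ := by
    have h0 : 0 ≤ |u| ^ δ := by positivity
    rcases le_total |u| 1 with hu | hu
    · have h1 : |u| ≤ |u| ^ δ := by
        conv_lhs => rw [← Real.rpow_one |u|]
        exact Real.rpow_le_rpow_of_exponent_ge_of_imp (abs_nonneg u) hu hδ.2
          fun _ h => absurd h one_ne_zero
      have := hconc (z - |u|) (z + |u|) (by linarith [abs_nonneg u])
      rw [hA]
      linarith
    · have h1 : 1 ≤ |u| ^ δ := Real.one_le_rpow hu hδ.1.le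
      have : P.real A ≤ 1 := measureReal_le_one
      linarith
  have hpt : ∀ ω, |steinDeriv z (V ω + u) - steinDeriv z (V ω + 0)| ≤
      (2 * |V ω| + 3) * |u| ^ δ + A.indicator 1 ω := by
    intro ω
    have h1 := abs_mul_steinSol_sub_le hδ z (V ω) u
    have h2 : |(Iic z).indicator (1 : ℝ → ℝ) (V ω + u) - (Iic z).indicator 1 (V ω)| ≤
        A.indicator 1 ω := by
      by_cases hω : ω ∈ A
      · rw [indicator_of_mem hω]
        by_cases h3 : V ω + u ∈ Iic z <;> by_cases h4 : V ω ∈ Iic z <;>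
          simp [indicator_of_mem, indicator_of_notMem, h3, h4]
      · rw [indicator_of_notMem hω]
        have hω' : V ω < z - |u| ∨ z + |u| < V ω := by
          by_contra! h
          exact hω ⟨h.1, h.2⟩
        rcases hω' with h | h
        · rw [indicator_of_mem (show V ω + u ∈ Iic z by
              rw [mem_Iic]; linarith [le_abs_self u]),
            indicator_of_mem (show V ω ∈ Iic z by rw [mem_Iic]; linarith [abs_nonneg u])]
          simp
        · rw [indicator_of_notMem (show V ω + u ∉ Iic z by
              rw [mem_Iic, not_le]; linarith [neg_abs_le u]),
            indicator_of_notMem (show V ω ∉ Iic z by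
              rw [mem_Iic, not_le]; linarith [abs_nonneg u])]
          simp
    have h3 : steinDeriv z (V ω + u) - steinDeriv z (V ω + 0) =
        ((V ω + u) * steinSol z (V ω + u) - V ω * steinSol z (V ω)) +
        ((Iic z).indicator (1 : ℝ → ℝ) (V ω + u) - (Iic z).indicator 1 (V ω)) := by
      rw [add_zero]
      unfold steinDeriv
      ring
    rw [h3]
    exact (abs_add_le _ _).trans (add_le_add h1 h2)
  have hg1 : Integrable (fun ω => (2 * |V ω| + 3) * |u| ^ δ) P :=
    ((hVi.const_mul 2).add (integrable_const 3)).mul_const _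
  have hg2 : Integrable (A.indicator (1 : Ω → ℝ)) P := (integrable_const 1).indicator hAm
  unfold steinShift
  rw [← integral_sub (integrable_steinDeriv_comp (hV.add_const u) z)
    (integrable_steinDeriv_comp (hV.add_const 0) z)]
  calc _ ≤ ∫ ω, |steinDeriv z (V ω + u) - steinDeriv z (V ω + 0)| ∂P := abs_integral_le_integral_abs
    _ ≤ ∫ ω, ((2 * |V ω| + 3) * |u| ^ δ + A.indicator 1 ω) ∂P := by
        refine integral_mono ((integrable_steinDeriv_comp (hV.add_const u) z).sub
          (integrable_steinDeriv_comp (hV.add_const 0) z)).abs (hg1.add hg2) hpt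
    _ = (2 * ∫ ω, |V ω| ∂P + 3) * |u| ^ δ + P.real A := by
        rw [integral_add hg1 hg2, integral_mul_const,
          integral_add (hVi.const_mul 2) (integrable_const 3), integral_const_mul,
          integral_indicator_one hAm]
        simp
    _ ≤ (2 * 1 + 3) * |u| ^ δ + (2 * |u| ^ δ + γ) := by gcongr
    _ = 7 * |u| ^ δ + γ := by ring

lemma integral_steinSol_sub (hV : Measurable V) (z u : ℝ) :
    ∫ ω, steinSol z (V ω + u) ∂P - ∫ ω, steinSol z (V ω) ∂P =
      ∫ t in (0 : ℝ)..u, steinShift P V z t := by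
  unfold steinShift
  rw [intervalIntegral_integral_swap, ← integral_sub
    (integrable_steinSol_comp (hV.add_const u) z) (integrable_steinSol_comp hV z)]
  · simp only [steinSol_sub_steinSol]
  · have : IsFiniteMeasure (volume.restrict (uIoc 0 u)) :=
      ⟨by rw [Measure.restrict_apply_univ, uIoc]; exact measure_Ioc_lt_top⟩
    refine Integrable.of_bound (C := 2) ?_ (Eventually.of_forall fun _ => abs_steinDeriv_le _ _)
    exact ((measurable_steinDeriv z).comp (by fun_prop :
      Measurable fun p : ℝ × Ω => V p.2 + p.1)).aestronglyMeasurable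

/-- The contribution of one summand `Y` to the two sides of Stein's equation: both are compared with
`E Y² · E f'(V)`, where `V` is the sum of the other summands. -/
lemma abs_stein_summand_le (hδ : δ ∈ Ioc (0 : ℝ) 1) (hVY : IndepFun V Y P) (hV : Measurable V)
    (hY : Measurable Y) (hint : Integrable (fun ω => |Y ω| ^ (2 + δ)) P)
    (h0 : ∫ ω, Y ω ∂P = 0) {z γ : ℝ}
    (hH : ∀ u, |steinShift P V z u - steinShift P V z 0| ≤ 7 * |u| ^ δ + γ) :
    |(∫ ω, Y ω ^ 2 ∂P) * ∫ ω, steinDeriv z (V ω + Y ω) ∂P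
        - ∫ ω, Y ω * steinSol z (V ω + Y ω) ∂P|
      ≤ 21 * ∫ ω, |Y ω| ^ (2 + δ) ∂P + 2 * γ * ∫ ω, Y ω ^ 2 ∂P := by
  have hδi := integrable_rpow_of_moment hδ hY hint
  have hY2 := memLp_two_of_moment hδ hY hint
  have hsq := hY2.integrable_sq
  have hYi := hY2.integrable one_le_two
  set H := steinShift P V z
  have hHm : Measurable H := measurable_steinShift hV z
  have hHY : Integrable (fun ω => H (Y ω)) P :=
    Integrable.of_bound (hHm.comp hY).aestronglyMeasurable 2
      (Eventually.of_forall fun _ => abs_steinShift_le _ _ _)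
  have hvar0 : 0 ≤ ∫ ω, Y ω ^ 2 ∂P := integral_nonneg fun _ => sq_nonneg _
  -- the derivative side
  have hD : ∫ ω, steinDeriv z (V ω + Y ω) ∂P = ∫ ω, H (Y ω) ∂P :=
    integral_comp_indep hVY hV hY (F := fun p => steinDeriv z (p.1 + p.2))
      ((measurable_steinDeriv z).comp (by fun_prop)) (integrable_steinDeriv_comp (hV.add hY) z)
  have hD2 : |∫ ω, H (Y ω) ∂P - H 0| ≤ 7 * ∫ ω, |Y ω| ^ δ ∂P + γ := by
    have : ∫ ω, H (Y ω) ∂P - H 0 = ∫ ω, (H (Y ω) - H 0) ∂P := by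
      rw [integral_sub hHY (integrable_const _)]
      simp
    rw [this]
    calc _ ≤ ∫ ω, |H (Y ω) - H 0| ∂P := abs_integral_le_integral_abs
      _ ≤ ∫ ω, (7 * |Y ω| ^ δ + γ) ∂P :=
          integral_mono (hHY.sub (integrable_const _)).abs
            ((hδi.const_mul 7).add (integrable_const _)) fun ω => hH (Y ω)
      _ = _ := by
          rw [integral_add (hδi.const_mul 7) (integrable_const _), integral_const_mul]
          simp
  -- the product side
  set K : ℝ → ℝ := fun u => ∫ ω, steinSol z (V ω + u) ∂P with hK
  have hKm : Measurable K := by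
    have : Measurable fun p : ℝ × Ω => steinSol z (V p.2 + p.1) :=
      (continuous_steinSol z).measurable.comp (by fun_prop)
    exact this.stronglyMeasurable.integral_prod_right'.measurable
  have hKb : ∀ u, |K u| ≤ 3 := fun u => by
    have := norm_integral_le_of_norm_le_const (μ := P) (f := fun ω => steinSol z (V ω + u)) (C := 3)
      (Eventually.of_forall fun _ => abs_steinSol_le _ _)
    simpa using this
  have hYK : Integrable (fun ω => Y ω * K (Y ω)) P :=
    hYi.mul_bdd (c := 3) (hKm.comp hY).aestronglyMeasurable (Eventually.of_forall fun _ => hKb _)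
  have hS : ∫ ω, Y ω * steinSol z (V ω + Y ω) ∂P = ∫ ω, Y ω * (K (Y ω) - K 0) ∂P := by
    have h1 : ∫ ω, Y ω * steinSol z (V ω + Y ω) ∂P = ∫ ω, Y ω * K (Y ω) ∂P := by
      rw [integral_comp_indep hVY hV hY (F := fun p => p.2 * steinSol z (p.1 + p.2))
        (measurable_snd.mul ((continuous_steinSol z).measurable.comp (by fun_prop)))
        (hYi.mul_bdd (c := 3) ((continuous_steinSol z).measurable.comp
          (hV.add hY)).aestronglyMeasurable (Eventually.of_forall fun _ => abs_steinSol_le _ _))]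
      simp only [integral_const_mul, hK]
    simp only [mul_sub]
    rw [h1, integral_sub hYK (hYi.mul_const _), integral_mul_const, h0, zero_mul, sub_zero]
  have hKu : ∀ u, |u * (K u - K 0) - u ^ 2 * H 0| ≤ 7 * |u| ^ (2 + δ) + γ * u ^ 2 := by
    intro u
    have h1 : K u - K 0 = ∫ t in (0 : ℝ)..u, H t := by
      have := integral_steinSol_sub (P := P) hV z u
      simpa [hK] using this
    have hHint : IntervalIntegrable H volume 0 u :=
      (intervalIntegrable_const (c := (2 : ℝ))).mono_fun hHm.aestronglyMeasurable
        (Eventually.of_forall fun t => by simpa using abs_steinShift_le V z t)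
    have h2 : K u - K 0 - u * H 0 = ∫ t in (0 : ℝ)..u, (H t - H 0) := by
      rw [intervalIntegral.integral_sub hHint intervalIntegrable_const, h1]
      simp
    have h3 : |K u - K 0 - u * H 0| ≤ (7 * |u| ^ δ + γ) * |u| := by
      rw [h2]
      have := intervalIntegral.norm_integral_le_of_norm_le_const (a := 0) (b := u)
        (f := fun t => H t - H 0) (C := 7 * |u| ^ δ + γ) (fun t ht => ?_)
      · simpa using this
      · refine (hH t).trans ?_
        have : |t| ≤ |u| := by
          rcases le_total 0 u with hu | hu
          · rw [uIoc_of_le hu] at ht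
            rw [abs_of_nonneg ht.1.le, abs_of_nonneg hu]
            exact ht.2
          · rw [uIoc_of_ge hu] at ht
            rw [abs_of_nonpos ht.2, abs_of_nonpos hu]
            linarith [ht.1]
        have hδ0 := hδ.1.le
        gcongr
    calc |u * (K u - K 0) - u ^ 2 * H 0| = |u| * |K u - K 0 - u * H 0| := by
          rw [← abs_mul]; ring_nf
      _ ≤ |u| * ((7 * |u| ^ δ + γ) * |u|) := by gcongr
      _ = 7 * (u ^ 2 * |u| ^ δ) + γ * u ^ 2 := by rw [← sq_abs u]; ring
      _ = _ := by rw [rpow_two_add hδ.1.le]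
  have hKint : Integrable (fun ω => Y ω * (K (Y ω) - K 0)) P := by
    simp only [mul_sub]
    exact hYK.sub (hYi.mul_const _)
  have hS2 : |∫ ω, Y ω * (K (Y ω) - K 0) ∂P - (∫ ω, Y ω ^ 2 ∂P) * H 0| ≤
      7 * ∫ ω, |Y ω| ^ (2 + δ) ∂P + γ * ∫ ω, Y ω ^ 2 ∂P := by
    rw [← integral_mul_const, ← integral_sub hKint (hsq.mul_const _)]
    calc _ ≤ ∫ ω, |Y ω * (K (Y ω) - K 0) - Y ω ^ 2 * H 0| ∂P := abs_integral_le_integral_abs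
      _ ≤ ∫ ω, (7 * |Y ω| ^ (2 + δ) + γ * Y ω ^ 2) ∂P :=
          integral_mono (hKint.sub (hsq.mul_const _)).abs
            ((hint.const_mul 7).add (hsq.const_mul γ)) fun ω => hKu (Y ω)
      _ = _ := by
          rw [integral_add (hint.const_mul 7) (hsq.const_mul γ), integral_const_mul,
            integral_const_mul]
  have hmix := sq_moment_mul_le hδ hY hint
  rw [hD, hS]
  have h5 : |(∫ ω, Y ω ^ 2 ∂P) * (∫ ω, H (Y ω) ∂P - H 0)| ≤
      (∫ ω, Y ω ^ 2 ∂P) * (7 * ∫ ω, |Y ω| ^ δ ∂P + γ) := by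
    rw [abs_mul, abs_of_nonneg hvar0]
    gcongr
  rw [abs_le] at h5 hS2 ⊢
  constructor <;> nlinarith

end Moments

/-! ### The Lyapunov bound -/

section BerryEsseen

variable {Ω : Type*} [MeasurableSpace Ω] {P : Measure Ω} [IsProbabilityMeasure P] {n : ℕ}
  {ξ : Fin n → Ω → ℝ} {δ : ℝ}

lemma IsCenteredFamily.memLp_two (hξ : IsCenteredFamily P δ ξ) (hδ : δ ∈ Ioc (0 : ℝ) 1)
    (i : Fin n) : MemLp (ξ i) 2 P :=
  memLp_two_of_moment hδ (hξ.measurable i) (hξ.moment i)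

lemma IsCenteredFamily.sq_moment_pos (hξ : IsCenteredFamily P δ ξ) (hδ : δ ∈ Ioc (0 : ℝ) 1)
    (i : Fin n) : 0 < ∫ ω, ξ i ω ^ 2 ∂P := by
  refine (integral_nonneg fun ω => sq_nonneg (ξ i ω)).lt_of_ne fun h => hξ.nondegenerate i ⟨0, ?_⟩
  have := (integral_eq_zero_iff_of_nonneg (fun ω => sq_nonneg (ξ i ω))
    (hξ.memLp_two hδ i).integrable_sq).1 h.symm
  filter_upwards [this] with ω hω
  simpa using hω

lemma IsCenteredFamily.sigma_pos (hξ : IsCenteredFamily P δ ξ) (hδ : δ ∈ Ioc (0 : ℝ) 1)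
    (hn : 1 ≤ n) : 0 < sigma P ξ :=
  Real.sqrt_pos.2 (Finset.sum_pos (fun i _ => hξ.sq_moment_pos hδ i) ⟨⟨0, hn⟩, Finset.mem_univ _⟩)

lemma sigma_sq (P : Measure Ω) (ξ : Fin n → Ω → ℝ) :
    sigma P ξ ^ 2 = ∑ i, ∫ ω, ξ i ω ^ 2 ∂P :=
  Real.sq_sqrt (Finset.sum_nonneg fun _ _ => integral_nonneg fun _ => sq_nonneg _)

omit [IsProbabilityMeasure P] in
lemma IsCenteredFamily.moment_pos (hξ : IsCenteredFamily P δ ξ)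
    (i : Fin n) : 0 < ∫ ω, |ξ i ω| ^ (2 + δ) ∂P := by
  refine (integral_nonneg fun ω => by positivity).lt_of_ne fun h => hξ.nondegenerate i ⟨0, ?_⟩
  have := (integral_eq_zero_iff_of_nonneg (fun ω => by positivity) (hξ.moment i)).1 h.symm
  filter_upwards [this] with ω hω
  by_contra hne
  exact (Real.rpow_pos_of_pos (abs_pos.2 hne) (2 + δ)).ne' hω

omit [IsProbabilityMeasure P] in
lemma IsCenteredFamily.momentSum_pos (hξ : IsCenteredFamily P δ ξ) (hn : 1 ≤ n) :
    0 < momentSum P δ ξ :=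
  Finset.sum_pos (fun i _ => hξ.moment_pos i) ⟨⟨0, hn⟩, Finset.mem_univ _⟩

omit [IsProbabilityMeasure P] in
lemma IsCenteredFamily.div_const (hξ : IsCenteredFamily P δ ξ) {c : ℝ}
    (hc : 0 < c) : IsCenteredFamily P δ fun i ω => ξ i ω / c where
  measurable i := (hξ.measurable i).div_const c
  indep := hξ.indep.comp (fun _ x => x / c) fun _ => measurable_id.div_const c
  nondegenerate i := by
    rintro ⟨d, hd⟩
    refine hξ.nondegenerate i ⟨d * c, ?_⟩
    filter_upwards [hd] with ω hω
    rw [← hω]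
    field_simp
  moment i := by
    have h : ∀ ω, |ξ i ω / c| ^ (2 + δ) = |ξ i ω| ^ (2 + δ) / c ^ (2 + δ) := fun ω => by
      rw [abs_div, abs_of_pos hc, Real.div_rpow (abs_nonneg _) hc.le]
    simp only [h]
    exact (hξ.moment i).div_const _
  mean_zero i := by
    rw [integral_div, hξ.mean_zero i, zero_div]

omit [IsProbabilityMeasure P] in
lemma momentSum_div_const {c : ℝ} (hc : 0 < c) :
    momentSum P δ (fun i ω => ξ i ω / c) = momentSum P δ ξ / c ^ (2 + δ) := by
  unfold momentSum
  rw [Finset.sum_div]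
  refine Finset.sum_congr rfl fun i _ => ?_
  rw [← integral_div]
  refine integral_congr_ae (Eventually.of_forall fun ω => ?_)
  simp only
  rw [abs_div, abs_of_pos hc, Real.div_rpow (abs_nonneg _) hc.le]

/-- When the normalized moment sum is small, no single summand dominates, so every leave-one-out
sum still satisfies a concentration inequality. -/
lemma IsCenteredFamily.measure_sum_erase_mem_Icc_le (hξ : IsCenteredFamily P δ ξ)
    (hδ : δ ∈ Ioc (0 : ℝ) 1) (hvar : ∑ i, ∫ ω, ξ i ω ^ 2 ∂P = 1) (hn : 1 ≤ n)
    (hβ : momentSum P δ ξ ≤ 1 / 64) (i : Fin n) {a b : ℝ} (hab : a ≤ b) :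
    P.real {ω | ∑ j ∈ Finset.univ.erase i, ξ j ω ∈ Icc a b} ≤ (b - a) + 16 * momentSum P δ ξ := by
  set β := momentSum P δ ξ
  have hβpos : 0 < β := hξ.momentSum_pos hn
  have hL := fun i => hξ.memLp_two hδ i
  have hmom0 : ∀ j, 0 ≤ ∫ ω, |ξ j ω| ^ (2 + δ) ∂P := fun j => (hξ.moment_pos j).le
  have hle : ∀ j, ∫ ω, |ξ j ω| ^ (2 + δ) ∂P ≤ β := fun j =>
    Finset.single_le_sum (f := fun j => ∫ ω, |ξ j ω| ^ (2 + δ) ∂P) (fun j _ => hmom0 j)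
      (Finset.mem_univ j)
  have herase : ∑ j ∈ Finset.univ.erase i, ∫ ω, ξ j ω ^ 2 ∂P = 1 - ∫ ω, ξ i ω ^ 2 ∂P := by
    rw [Finset.sum_erase_eq_sub (Finset.mem_univ i), hvar]
  -- truncating at `1 / 4` shows that the omitted summand carries at most a quarter of the variance
  have hi : ∫ ω, ξ i ω ^ 2 ∂P ≤ 1 / 4 := by
    calc ∫ ω, ξ i ω ^ 2 ∂P ≤ ∫ ω, ((1 / 4) ^ 2 + 2 * |ξ i ω| ^ (2 + δ) / (1 / 4)) ∂P :=
          integral_mono (hL i).integrable_sq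
            ((integrable_const _).add (((hξ.moment i).const_mul 2).div_const _))
            fun ω => sq_le_sq_add hδ (by norm_num) (by norm_num) _
      _ = (1 / 4) ^ 2 + 2 * (∫ ω, |ξ i ω| ^ (2 + δ) ∂P) / (1 / 4) := by
          rw [integral_add (integrable_const _) (((hξ.moment i).const_mul 2).div_const _),
            integral_div, integral_const_mul]
          simp
      _ ≤ (1 / 4) ^ 2 + 2 * (1 / 64) / (1 / 4) := by
          have := (hle i).trans hβ
          gcongr
      _ ≤ 1 / 4 := by norm_num
  -- at level `α = 4 β ≤ 1`, truncation loses at most `β / α = 1 / 4` of the remaining variance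
  have htr : ∀ j, ∫ ω, ξ j ω ^ 2 ∂P - (∫ ω, |ξ j ω| ^ (2 + δ) ∂P) / (4 * β) ≤
      ∫ ω, |ξ j ω| * min |ξ j ω| (4 * β) ∂P := by
    intro j
    rw [← integral_div, ← integral_sub (hL j).integrable_sq ((hξ.moment j).div_const _)]
    have hm := hξ.measurable j
    refine integral_mono ((hL j).integrable_sq.sub ((hξ.moment j).div_const _))
      ((hL j).integrable_sq.mono' (by fun_prop) (Eventually.of_forall fun ω => ?_)) fun ω => ?_
    · rw [Real.norm_of_nonneg (by positivity), ← sq_abs, sq]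
      gcongr
      exact min_le_left _ _
    · have := sq_le_mul_min_add hδ (t := 4 * β) (by positivity) (by linarith) (ξ j ω)
      simp only
      linarith
  have hsumle : ∑ j ∈ Finset.univ.erase i, ∫ ω, |ξ j ω| ^ (2 + δ) ∂P ≤ β :=
    Finset.sum_le_sum_of_subset_of_nonneg (Finset.erase_subset _ _) fun j _ _ => hmom0 j
  have hvar0 : 0 ≤ ∫ ω, ξ i ω ^ 2 ∂P := (hξ.sq_moment_pos hδ i).le
  have hmain := measure_sum_mem_Icc_le (s := Finset.univ.erase i) hξ.indep hξ.measurable hL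
    hξ.mean_zero (α := 4 * β) (by positivity) (by rw [herase]; linarith) ?_ hab
  · linarith
  · calc (1 : ℝ) / 2 ≤ (1 - ∫ ω, ξ i ω ^ 2 ∂P) - β / (4 * β) := by
          have : β / (4 * β) = 1 / 4 := by field_simp
          rw [this]
          linarith
      _ ≤ ∑ j ∈ Finset.univ.erase i, (∫ ω, ξ j ω ^ 2 ∂P) -
          (∑ j ∈ Finset.univ.erase i, ∫ ω, |ξ j ω| ^ (2 + δ) ∂P) / (4 * β) := by
          rw [herase]
          gcongr
      _ = ∑ j ∈ Finset.univ.erase i,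
          (∫ ω, ξ j ω ^ 2 ∂P - (∫ ω, |ξ j ω| ^ (2 + δ) ∂P) / (4 * β)) := by
          rw [Finset.sum_sub_distrib, Finset.sum_div]
      _ ≤ _ := Finset.sum_le_sum fun j _ => htr j

/-- The Lyapunov bound for a family of unit total variance. -/
lemma IsCenteredFamily.abs_measure_sub_Phi_le (hξ : IsCenteredFamily P δ ξ)
    (hδ : δ ∈ Ioc (0 : ℝ) 1) (hvar : ∑ i, ∫ ω, ξ i ω ^ 2 ∂P = 1) (hn : 1 ≤ n) (z : ℝ) :
    |P.real {ω | sumS ξ ω ≤ z} - Phi z| ≤ 64 * momentSum P δ ξ := by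
  set β := momentSum P δ ξ
  have hβpos : 0 < β := hξ.momentSum_pos hn
  rcases lt_or_ge (1 / 64) β with hβ | hβ
  · -- the right-hand side exceeds one
    have h1 : P.real {ω | sumS ξ ω ≤ z} ≤ 1 := measureReal_le_one
    have h2 : 0 ≤ P.real {ω | sumS ξ ω ≤ z} := measureReal_nonneg
    have h3 := Phi_nonneg z
    have h4 := Phi_le_one z
    rw [abs_le]
    constructor <;> linarith
  have hL := fun i => hξ.memLp_two hδ i
  have hSm : Measurable (sumS ξ) := Finset.measurable_sum _ fun i _ => hξ.measurable i
  have hsplit : ∀ i ω, sumS ξ ω = ∑ j ∈ Finset.univ.erase i, ξ j ω + ξ i ω := fun i ω =>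
    (Finset.sum_erase_add _ _ (Finset.mem_univ i)).symm
  have hsummand : ∀ i, |(∫ ω, ξ i ω ^ 2 ∂P) * ∫ ω, steinDeriv z (sumS ξ ω) ∂P
        - ∫ ω, ξ i ω * steinSol z (sumS ξ ω) ∂P|
      ≤ 21 * ∫ ω, |ξ i ω| ^ (2 + δ) ∂P + 2 * (16 * β) * ∫ ω, ξ i ω ^ 2 ∂P := by
    intro i
    simp only [hsplit i]
    have hVL : MemLp (fun ω => ∑ j ∈ Finset.univ.erase i, ξ j ω) 2 P :=
      memLp_finsetSum _ fun j _ => hL j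
    refine abs_stein_summand_le hδ (indepFun_sum_erase hξ.indep hξ.measurable i)
      (Finset.measurable_sum _ fun j _ => hξ.measurable j) (hξ.measurable i) (hξ.moment i)
      (hξ.mean_zero i) fun u => ?_
    refine abs_steinShift_sub_le hδ (Finset.measurable_sum _ fun j _ => hξ.measurable j) hVL ?_
      (by positivity) (fun a b hab => hξ.measure_sum_erase_mem_Icc_le hδ hvar hn hβ i hab) z u
    rw [integral_sq_sum hξ.indep hL hξ.mean_zero, ← hvar]
    exact Finset.sum_le_sum_of_subset_of_nonneg (Finset.erase_subset _ _)
      fun j _ _ => (hξ.sq_moment_pos hδ j).le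
  have hξf : ∀ i, Integrable (fun ω => ξ i ω * steinSol z (sumS ξ ω)) P := fun i =>
    ((hL i).integrable one_le_two).mul_bdd (c := 3)
      ((continuous_steinSol z).measurable.comp hSm).aestronglyMeasurable
      (Eventually.of_forall fun _ => abs_steinSol_le _ _)
  have hstein : P.real {ω | sumS ξ ω ≤ z} - Phi z =
      ∫ ω, steinDeriv z (sumS ξ ω) ∂P - ∫ ω, sumS ξ ω * steinSol z (sumS ξ ω) ∂P := by
    have hAm : MeasurableSet {ω | sumS ξ ω ≤ z} := hSm measurableSet_Iic
    rw [← integral_sub (integrable_steinDeriv_comp hSm z) (integrable_mul_steinSol_comp hSm z)]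
    have : ∀ ω, steinDeriv z (sumS ξ ω) - sumS ξ ω * steinSol z (sumS ξ ω) =
        {ω | sumS ξ ω ≤ z}.indicator 1 ω - Phi z := fun ω => by
      rw [steinDeriv, show (Iic z).indicator (1 : ℝ → ℝ) (sumS ξ ω) =
        {ω | sumS ξ ω ≤ z}.indicator 1 ω from rfl]
      ring
    simp only [this]
    rw [integral_sub ((integrable_const 1).indicator hAm) (integrable_const _),
      integral_indicator_one hAm]
    simp
  have hsum : ∫ ω, sumS ξ ω * steinSol z (sumS ξ ω) ∂P =
      ∑ i, ∫ ω, ξ i ω * steinSol z (sumS ξ ω) ∂P := by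
    rw [← integral_finsetSum _ fun i _ => hξf i]
    simp only [← Finset.sum_mul]
    rfl
  have hone : ∫ ω, steinDeriv z (sumS ξ ω) ∂P =
      ∑ i, (∫ ω, ξ i ω ^ 2 ∂P) * ∫ ω, steinDeriv z (sumS ξ ω) ∂P := by
    rw [← Finset.sum_mul, hvar, one_mul]
  rw [hstein, hsum, hone, ← Finset.sum_sub_distrib]
  calc _ ≤ ∑ i, |(∫ ω, ξ i ω ^ 2 ∂P) * ∫ ω, steinDeriv z (sumS ξ ω) ∂P
        - ∫ ω, ξ i ω * steinSol z (sumS ξ ω) ∂P| := Finset.abs_sum_le_sum_abs _ _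
    _ ≤ ∑ i, (21 * ∫ ω, |ξ i ω| ^ (2 + δ) ∂P + 2 * (16 * β) * ∫ ω, ξ i ω ^ 2 ∂P) :=
        Finset.sum_le_sum fun i _ => hsummand i
    _ = 21 * β + 2 * (16 * β) * 1 := by
        rw [Finset.sum_add_distrib, ← Finset.mul_sum, ← Finset.mul_sum, hvar]
        rfl
    _ ≤ 64 * β := by linarith

end BerryEsseen

/-- The Lyapunov bound of order `2 + δ` holds with an absolute constant, so that `lyapunovConst` is
an infimum over a nonempty set. -/
theorem isLyapunovBound_const {δ : ℝ} (hδ : δ ∈ Ioc (0 : ℝ) 1) : IsLyapunovBound δ 64 := by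
  intro n hn Ω _ P _ ξ hξ y
  have hσ := hξ.sigma_pos hδ hn
  have hσ2 := sigma_sq P ξ
  have h := (hξ.div_const hσ).abs_measure_sub_Phi_le hδ ?_ hn y
  · rw [momentSum_div_const hσ] at h
    have hset : ∀ ω, sumS (fun i ω => ξ i ω / sigma P ξ) ω ≤ y ↔ sumS ξ ω ≤ y * sigma P ξ :=
      fun ω => by
        rw [show sumS (fun i ω => ξ i ω / sigma P ξ) ω = sumS ξ ω / sigma P ξ from
          (Finset.sum_div _ _ _).symm, div_le_iff₀ hσ]
    simpa only [hset] using h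
  · simp only [div_pow, integral_div]
    rw [← Finset.sum_div, ← hσ2, div_self (by positivity)]

/-! ### The Lyapunov constant -/

/-- The infimum `lyapunovConst` is itself admissible, in every universe: a family on an arbitrary
probability space is replaced by the coordinates under its joint law. -/
lemma IsCenteredFamily.abs_measure_sub_Phi_le_lyapunovConst {Ω : Type*} [MeasurableSpace Ω]
    {P : Measure Ω} [IsProbabilityMeasure P] {n : ℕ} {ξ : Fin n → Ω → ℝ} {δ : ℝ}
    (hξ : IsCenteredFamily P δ ξ) (hδ : δ ∈ Ioc (0 : ℝ) 1) (hn : 1 ≤ n) (y : ℝ) :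
    |P.real {ω | sumS ξ ω ≤ y * sigma P ξ} - Phi y| ≤
      lyapunovConst δ * (momentSum P δ ξ / sigma P ξ ^ (2 + δ)) := by
  have hm : Measurable fun ω i => ξ i ω := measurable_pi_lambda _ hξ.measurable
  set Q : Measure (Fin n → ℝ) := P.map fun ω i => ξ i ω with hQ
  have hQp : IsProbabilityMeasure Q := Measure.isProbabilityMeasure_map hm.aemeasurable
  set X : Fin n → (Fin n → ℝ) → ℝ := fun i v => v i
  have hint : ∀ i (g : ℝ → ℝ), Measurable g → ∫ v, g (X i v) ∂Q = ∫ ω, g (ξ i ω) ∂P :=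
    fun i g hg => integral_map hm.aemeasurable
      (hg.comp (measurable_pi_apply i)).aestronglyMeasurable
  have hXfam : IsCenteredFamily Q δ X := by
    refine ⟨fun i => measurable_pi_apply i, ?_, fun i => ?_, fun i => ?_, fun i => ?_⟩
    · rw [iIndepFun_iff_map_fun_eq_pi_map fun i => (measurable_pi_apply i).aemeasurable]
      have h1 : ∀ i, Q.map (X i) = P.map (ξ i) := fun i =>
        Measure.map_map (measurable_pi_apply i) hm
      rw [funext h1,
        ← (iIndepFun_iff_map_fun_eq_pi_map fun i => (hξ.measurable i).aemeasurable).1 hξ.indep]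
      exact Measure.map_id
    · rintro ⟨c, hc⟩
      exact hξ.nondegenerate i ⟨c, ae_of_ae_map hm.aemeasurable hc⟩
    · have hXm : Measurable fun v => |X i v| ^ (2 + δ) :=
        (measurable_norm.comp (measurable_pi_apply i)).pow_const _
      exact (integrable_map_measure hXm.aestronglyMeasurable hm.aemeasurable).2 (hξ.moment i)
    · exact (hint i id measurable_id).trans (hξ.mean_zero i)
  have hsigma : sigma Q X = sigma P ξ := by
    unfold sigma
    simp only [hint _ (fun t => t ^ 2) (by fun_prop)]
  have hmom : momentSum Q δ X = momentSum P δ ξ := by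
    unfold momentSum
    simp only [hint _ (fun t => |t| ^ (2 + δ)) (measurable_norm.pow_const _)]
  have hprob : ∀ c, Q.real {v | sumS X v ≤ c} = P.real {ω | sumS ξ ω ≤ c} := fun c =>
    map_measureReal_apply hm ((Finset.measurable_sum _ fun i _ => measurable_pi_apply i)
      measurableSet_Iic)
  have hR : 0 < momentSum P δ ξ / sigma P ξ ^ (2 + δ) :=
    div_pos (hξ.momentSum_pos hn) (Real.rpow_pos_of_pos (hξ.sigma_pos hδ hn) _)
  rw [← div_le_iff₀ hR]
  refine le_csInf ⟨64, isLyapunovBound_const hδ⟩ fun C hC => ?_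
  rw [div_le_iff₀ hR]
  have := hC n hn _ _ Q hQp X hXfam y
  rwa [hsigma, hmom, hprob] at this

/-! ### Exponential functionals and Kolmogorov distance -/

/-- The normal Laplace functional `E e^{-aN} 1_{N > 0} = Θ(a)`. -/
lemma integral_exp_neg_gaussianReal (a : ℝ) :
    ∫ u, (Ioi (0 : ℝ)).indicator (fun u => Real.exp (-(a * u))) u ∂(gaussianReal 0 1) =
      Theta a := by
  rw [integral_gaussianReal_eq_integral_smul one_ne_zero]
  have h : ∀ u, gaussianPDFReal 0 1 u • (Ioi (0 : ℝ)).indicator (fun u => Real.exp (-(a * u))) u =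
      Real.exp (a ^ 2 / 2) * (Ioi a).indicator (gaussianPDFReal 0 1) (u + a) := by
    intro u
    by_cases hu : 0 < u
    · rw [indicator_of_mem (show u ∈ Ioi 0 from hu),
        indicator_of_mem (show u + a ∈ Ioi a by rw [mem_Ioi]; linarith), smul_eq_mul,
        gaussianPDFReal_zero_one, gaussianPDFReal_zero_one, mul_assoc, ← Real.exp_add,
        mul_left_comm, ← Real.exp_add]
      ring_nf
    · rw [indicator_of_notMem (show u ∉ Ioi 0 from hu),
        indicator_of_notMem (show u + a ∉ Ioi a by rw [mem_Ioi]; linarith)]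
      simp
  simp only [h]
  rw [integral_const_mul, integral_add_right_eq_self fun u => (Ioi a).indicator
    (gaussianPDFReal 0 1) u, integral_indicator measurableSet_Ioi, ← one_sub_Phi_eq_integral, Theta,
    mul_comm]

/-- The layers of `u ↦ e^{-au} 1_{u > 0}` are intervals with left end point `0`, so a bound `D` on
the distance of distribution functions bounds each of their masses within `2 D`. -/
lemma abs_measure_layer_sub_le {μ : Measure ℝ} [IsProbabilityMeasure μ] {D : ℝ}
    (hD : ∀ y, |μ.real (Iic y) - Phi y| ≤ D) {a t : ℝ} (ha : 0 ≤ a) (ht : t ∈ Ioc (0 : ℝ) 1) :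
    |μ.real {u | t ≤ (Ioi (0 : ℝ)).indicator (fun u => Real.exp (-(a * u))) u} -
      (gaussianReal 0 1).real
        {u | t ≤ (Ioi (0 : ℝ)).indicator (fun u => Real.exp (-(a * u))) u}| ≤ 2 * D := by
  have hD0 := hD 0
  have hDpos : 0 ≤ D := (abs_nonneg _).trans hD0
  rcases ha.eq_or_lt with rfl | ha
  · have hset : {u : ℝ | t ≤ (Ioi (0 : ℝ)).indicator (fun u => Real.exp (-(0 * u))) u} = Ioi 0 := by
      ext u
      by_cases hu : u ∈ Ioi (0 : ℝ)
      · simpa [indicator_of_mem, hu] using ht.2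
      · simpa [indicator_of_notMem, hu] using ht.1
    have h : μ.real (Ioi 0) = 1 - μ.real (Iic 0) := by
      rw [← compl_Iic, probReal_compl_eq_one_sub measurableSet_Iic]
    rw [hset, h, ← one_sub_Phi_eq_real]
    rw [abs_le] at hD0 ⊢
    constructor <;> linarith
  · set c : ℝ := -Real.log t / a with hc
    have hc0 : 0 ≤ c := div_nonneg (neg_nonneg.2 (Real.log_nonpos ht.1.le ht.2)) ha.le
    have hset : {u : ℝ | t ≤ (Ioi (0 : ℝ)).indicator (fun u => Real.exp (-(a * u))) u} =
        Iic c \ Iic 0 := by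
      ext u
      by_cases hu : u ∈ Ioi (0 : ℝ)
      · have : t ≤ Real.exp (-(a * u)) ↔ u ≤ c := by
          rw [← Real.log_le_iff_le_exp ht.1, hc, le_div_iff₀ ha, mul_comm u a]
          constructor <;> intro h <;> linarith
        have hu' : ¬ u ≤ 0 := not_le.2 hu
        rw [mem_ofPred_eq, indicator_of_mem hu, this, Set.mem_sdiff, mem_Iic, mem_Iic]
        simp [hu']
      · have hu' : u ≤ 0 := not_lt.1 hu
        rw [mem_ofPred_eq, indicator_of_notMem hu, Set.mem_sdiff, mem_Iic, mem_Iic]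
        simp [hu', ht.1]
    have hdiff : ∀ ν : Measure ℝ, IsProbabilityMeasure ν →
        ν.real (Iic c \ Iic 0) = ν.real (Iic c) - ν.real (Iic 0) := fun ν _ =>
      measureReal_sdiff (Iic_subset_Iic.2 hc0) measurableSet_Iic
    rw [hset, hdiff μ inferInstance, hdiff _ inferInstance, ← Phi_eq_real, ← Phi_eq_real]
    have hDc := hD c
    rw [abs_le] at hD0 hDc ⊢
    constructor <;> linarith

/-- Integrating `e^{-au} 1_{u > 0}` layer by layer, a bound on the Kolmogorov distance to the normal
law becomes a bound on the distance of the integral to `Θ(a)`. -/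
lemma abs_integral_exp_neg_sub_Theta_le {μ : Measure ℝ} [IsProbabilityMeasure μ] {D : ℝ}
    (hD : ∀ y, |μ.real (Iic y) - Phi y| ≤ D) {a : ℝ} (ha : 0 ≤ a) :
    |∫ u, (Ioi (0 : ℝ)).indicator (fun u => Real.exp (-(a * u))) u ∂μ - Theta a| ≤ 2 * D := by
  set f : ℝ → ℝ := (Ioi (0 : ℝ)).indicator (fun u => Real.exp (-(a * u))) with hf
  have hf0 : ∀ u, 0 ≤ f u := fun u => indicator_nonneg (fun _ _ => (Real.exp_pos _).le) u
  have hf1 : ∀ u, f u ≤ 1 := fun u => by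
    refine indicator_apply_le' (fun hu => ?_) fun _ => zero_le_one
    rw [Real.exp_le_one_iff, neg_nonpos]
    exact mul_nonneg ha (le_of_lt hu)
  have hfm : Measurable f := (by fun_prop : Measurable fun u : ℝ => Real.exp (-(a * u))).indicator
    measurableSet_Ioi
  have hcake : ∀ ν : Measure ℝ, IsProbabilityMeasure ν →
      ∫ u, f u ∂ν = ∫ t in Ioc 0 1, ν.real {u | t ≤ f u} := fun ν _ =>
    (Integrable.of_bound hfm.aestronglyMeasurable 1 (Eventually.of_forall fun u => by
      rw [Real.norm_of_nonneg (hf0 u)]; exact hf1 u)).integral_eq_integral_Ioc_meas_le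
      (Eventually.of_forall hf0) (Eventually.of_forall hf1)
  have hint : ∀ ν : Measure ℝ, IsProbabilityMeasure ν →
      IntegrableOn (fun t => ν.real {u | t ≤ f u}) (Ioc 0 1) := fun ν _ => by
    have hanti : Antitone fun t => ν.real {u | t ≤ f u} := fun s t hst =>
      measureReal_mono fun u hu => le_trans hst hu
    refine Measure.integrableOn_of_bounded (M := 1) measure_Ioc_lt_top.ne
      hanti.measurable.aestronglyMeasurable (Eventually.of_forall fun t => ?_)
    rw [Real.norm_of_nonneg measureReal_nonneg]
    exact measureReal_le_one
  rw [← integral_exp_neg_gaussianReal, hcake μ inferInstance, hcake _ inferInstance,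
    ← integral_sub (hint μ inferInstance) (hint _ inferInstance)]
  have := norm_setIntegral_le_of_norm_le_const (μ := volume) (s := Ioc (0 : ℝ) 1)
    (f := fun t => μ.real {u | t ≤ f u} - (gaussianReal 0 1).real {u | t ≤ f u}) (C := 2 * D)
    measure_Ioc_lt_top fun t ht => abs_measure_layer_sub_le hD ha ht
  simpa using this

/-! ### Exponential moments of a variable bounded above -/

section ExpMoments

variable {Ω : Type*} [MeasurableSpace Ω] {P : Measure Ω} {Y : Ω → ℝ} {B l : ℝ}

lemma exp_mul_le (hl : 0 ≤ l) {y : ℝ} (hy : y ≤ B) : Real.exp (l * y) ≤ Real.exp (B * l) := by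
  rw [mul_comm B]
  gcongr

lemma integrable_mul_exp (hY : Measurable Y) (hYB : ∀ᵐ ω ∂P, Y ω ≤ B) (hl : 0 ≤ l) {g : Ω → ℝ}
    (hg : Integrable g P) : Integrable (fun ω => Real.exp (l * Y ω) * g ω) P :=
  hg.bdd_mul (c := Real.exp (B * l)) (by fun_prop : Measurable fun ω =>
    Real.exp (l * Y ω)).aestronglyMeasurable (by
      filter_upwards [hYB] with ω hω
      rw [Real.norm_of_nonneg (Real.exp_pos _).le]
      exact exp_mul_le hl hω)

lemma integrable_exp_of_le [IsFiniteMeasure P] (hY : Measurable Y) (hYB : ∀ᵐ ω ∂P, Y ω ≤ B)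
    (hl : 0 ≤ l) : Integrable (fun ω => Real.exp (l * Y ω)) P := by
  simpa using integrable_mul_exp hY hYB hl (integrable_const (1 : ℝ))

/-- Jensen's inequality for the exponential of a centered variable. -/
lemma one_le_integral_exp [IsProbabilityMeasure P] (hY : Integrable Y P) (h0 : ∫ ω, Y ω ∂P = 0)
    (hexp : Integrable (fun ω => Real.exp (l * Y ω)) P) : 1 ≤ ∫ ω, Real.exp (l * Y ω) ∂P := by
  calc (1 : ℝ) = ∫ ω, (l * Y ω + 1) ∂P := by
        rw [integral_add (hY.const_mul l) (integrable_const 1), integral_const_mul, h0]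
        simp
    _ ≤ _ := integral_mono ((hY.const_mul l).add (integrable_const 1)) hexp fun ω =>
        Real.add_one_le_exp _

lemma abs_exp_sub_exp_le {a b c : ℝ} (ha : a ≤ c) (hb : b ≤ c) :
    |Real.exp a - Real.exp b| ≤ |a - b| * Real.exp c := by
  wlog hab : b ≤ a generalizing a b
  · rw [abs_sub_comm, abs_sub_comm a b]
    exact this hb ha (le_of_not_ge hab)
  rw [abs_of_nonneg (sub_nonneg.2 (Real.exp_le_exp.2 hab)), abs_of_nonneg (sub_nonneg.2 hab)]
  calc Real.exp a - Real.exp b = (1 - Real.exp (b - a)) * Real.exp a := by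
        rw [sub_mul, ← Real.exp_add]; ring_nf
    _ ≤ (a - b) * Real.exp c := by
        have := Real.add_one_le_exp (b - a)
        exact mul_le_mul (by linarith) (Real.exp_le_exp.2 ha) (Real.exp_pos _).le (by linarith)

/-- Differentiation under the integral sign, on the half-line where the exponential moments of a
variable bounded above are finite, end point included. -/
lemma hasDerivWithinAt_integral_exp (hY : Measurable Y) (hYi : Integrable Y P)
    [IsFiniteMeasure P] (hB : 0 ≤ B) (hYB : ∀ᵐ ω ∂P, Y ω ≤ B) (hl : 0 ≤ l) :
    HasDerivWithinAt (fun l => ∫ ω, Real.exp (l * Y ω) ∂P) (∫ ω, Real.exp (l * Y ω) * Y ω ∂P)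
      (Ici 0) l := by
  rw [hasDerivWithinAt_iff_tendsto_slope]
  have hev : ∀ᶠ y in 𝓝[Ici 0 \ {l}] l, y ∈ Ici (0 : ℝ) \ {l} := self_mem_nhdsWithin
  have hev2 : ∀ᶠ y in 𝓝[Ici 0 \ {l}] l, y < l + 1 :=
    nhdsWithin_le_nhds (Iio_mem_nhds (by linarith))
  have heq : (fun y => ∫ ω, (y - l)⁻¹ * (Real.exp (y * Y ω) - Real.exp (l * Y ω)) ∂P)
      =ᶠ[𝓝[Ici 0 \ {l}] l] slope (fun l => ∫ ω, Real.exp (l * Y ω) ∂P) l := by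
    filter_upwards [hev] with y hy
    rw [slope_def_module, integral_const_mul, integral_sub (integrable_exp_of_le hY hYB hy.1)
      (integrable_exp_of_le hY hYB hl), smul_eq_mul]
  refine Tendsto.congr' heq ?_
  refine tendsto_integral_filter_of_dominated_convergence
    (fun ω => |Y ω| * Real.exp ((l + 1) * B)) ?_ ?_ (hYi.abs.mul_const _) ?_
  · exact Eventually.of_forall fun y => by fun_prop
  · filter_upwards [hev, hev2] with y hy hy1
    filter_upwards [hYB] with ω hω
    have hyl : y - l ≠ 0 := sub_ne_zero.2 hy.2
    have hbound : ∀ s, 0 ≤ s → s ≤ l + 1 → s * Y ω ≤ (l + 1) * B := fun s h0 h1 =>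
      (mul_le_mul_of_nonneg_left hω h0).trans (mul_le_mul_of_nonneg_right h1 hB)
    rw [Real.norm_eq_abs, abs_mul, abs_inv]
    calc |y - l|⁻¹ * |Real.exp (y * Y ω) - Real.exp (l * Y ω)|
        ≤ |y - l|⁻¹ * (|y * Y ω - l * Y ω| * Real.exp ((l + 1) * B)) := by
          gcongr
          exact abs_exp_sub_exp_le (hbound y hy.1 hy1.le) (hbound l hl (by linarith))
      _ = (|y - l|⁻¹ * |y - l|) * (|Y ω| * Real.exp ((l + 1) * B)) := by
          rw [← sub_mul, abs_mul]; ring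
      _ = _ := by rw [inv_mul_cancel₀ (abs_ne_zero.2 hyl), one_mul]
  · refine Eventually.of_forall fun ω => ?_
    have hd : HasDerivAt (fun l => Real.exp (l * Y ω)) (Real.exp (l * Y ω) * Y ω) l := by
      have := ((hasDerivAt_id l).mul_const (Y ω)).exp
      simpa using this
    have := hasDerivWithinAt_iff_tendsto_slope.1 (hd.hasDerivWithinAt (s := Ici 0))
    refine this.congr fun y => ?_
    rw [slope_def_module, smul_eq_mul]

lemma abs_sub_rpow_le {p : ℝ} (hp : 1 ≤ p) (a b : ℝ) :
    |a - b| ^ p ≤ 2 ^ (p - 1) * (|a| ^ p + |b| ^ p) := by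
  have hp0 : 0 ≤ p := zero_le_one.trans hp
  calc |a - b| ^ p ≤ (|a| + |b|) ^ p := by
        gcongr
        exact abs_sub _ _
    _ ≤ _ := by exact_mod_cast NNReal.rpow_add_le_mul_rpow_add_rpow ‖a‖₊ ‖b‖₊ hp

/-- Centering costs at most a factor `2^p` in the absolute moment of order `p`. -/
lemma integral_abs_sub_mean_rpow_le [IsProbabilityMeasure P] {p : ℝ} (hp : 1 ≤ p)
    (hY : Integrable Y P) (hint : Integrable (fun ω => |Y ω| ^ p) P) :
    Integrable (fun ω => |Y ω - ∫ ω', Y ω' ∂P| ^ p) P ∧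
    ∫ ω, |Y ω - ∫ ω', Y ω' ∂P| ^ p ∂P ≤ 2 ^ p * ∫ ω, |Y ω| ^ p ∂P := by
  set b := ∫ ω', Y ω' ∂P with hb
  have hp0 : 0 ≤ p := zero_le_one.trans hp
  have hbp : |b| ^ p ≤ ∫ ω, |Y ω| ^ p ∂P := by
    calc |b| ^ p ≤ (∫ ω, |Y ω| ∂P) ^ p := by
          gcongr
          exact abs_integral_le_integral_abs
      _ ≤ _ := (convexOn_rpow hp).map_integral_le
          (Real.continuous_rpow_const hp0).continuousOn isClosed_Ici
          (Eventually.of_forall fun ω => abs_nonneg (Y ω)) hY.abs hint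
  have hdom : Integrable (fun ω => 2 ^ (p - 1) * (|Y ω| ^ p + |b| ^ p)) P :=
    (hint.add (integrable_const _)).const_mul _
  have hi : Integrable (fun ω => |Y ω - b| ^ p) P := by
    refine hdom.mono' ?_ (Eventually.of_forall fun ω => ?_)
    · exact (Real.continuous_rpow_const hp0).comp_aestronglyMeasurable
        (hY.aestronglyMeasurable.sub aestronglyMeasurable_const).norm
    · rw [Real.norm_of_nonneg (by positivity)]
      exact abs_sub_rpow_le hp _ _
  refine ⟨hi, ?_⟩
  calc ∫ ω, |Y ω - b| ^ p ∂P ≤ ∫ ω, 2 ^ (p - 1) * (|Y ω| ^ p + |b| ^ p) ∂P :=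
        integral_mono hi hdom fun ω => abs_sub_rpow_le hp _ _
    _ = 2 ^ (p - 1) * (∫ ω, |Y ω| ^ p ∂P + |b| ^ p) := by
        rw [integral_const_mul, integral_add hint (integrable_const _)]
        simp
    _ ≤ 2 ^ (p - 1) * (∫ ω, |Y ω| ^ p ∂P + ∫ ω, |Y ω| ^ p ∂P) := by gcongr
    _ = 2 ^ p * ∫ ω, |Y ω| ^ p ∂P := by
        rw [Real.rpow_sub_one two_ne_zero]
        ring

end ExpMoments

/-! ### The conjugate measure -/

section Conjugate

variable {Ω : Type*} [MeasurableSpace Ω] {P : Measure Ω} [IsProbabilityMeasure P] {n : ℕ}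
  {ξ : Fin n → Ω → ℝ} {δ B l : ℝ}

omit [IsProbabilityMeasure P] in
lemma conjMeasure_eq_tilted (hind : iIndepFun ξ P) (hm : ∀ i, Measurable (ξ i)) :
    conjMeasure P ξ l = P.tilted fun ω => l * sumS ξ ω := by
  have hmgf : ∫ ω, Real.exp (l * sumS ξ ω) ∂P = ∏ i, ∫ ω, Real.exp (l * ξ i ω) ∂P := by
    have := hind.mgf_sum (t := l) hm Finset.univ
    simpa [mgf, sumS] using this
  unfold conjMeasure Measure.tilted
  congr 1
  ext ω
  rw [esscherDensity, hmgf, Finset.prod_div_distrib, ← Real.exp_sum, ← Finset.mul_sum]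
  rfl

/-- Under the conjugate measure the summands stay independent, and each follows its own
exponentially tilted law. -/
lemma map_conjMeasure (hind : iIndepFun ξ P) (hm : ∀ i, Measurable (ξ i))
    (hexp : ∀ i, Integrable (fun ω => Real.exp (l * ξ i ω)) P) :
    (conjMeasure P ξ l).map (fun ω i => ξ i ω) =
      Measure.pi fun i => (P.tilted fun ω => l * ξ i ω).map (ξ i) := by
  have hT : ∀ i, IsProbabilityMeasure (P.tilted fun ω => l * ξ i ω) := fun i =>
    isProbabilityMeasure_tilted (hexp i)
  have hTm : ∀ i, IsProbabilityMeasure ((P.tilted fun ω => l * ξ i ω).map (ξ i)) := fun i =>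
    Measure.isProbabilityMeasure_map (hm i).aemeasurable
  refine (Measure.pi_eq fun s hs => ?_).symm
  have hmξ : Measurable fun ω i => ξ i ω := measurable_pi_lambda _ hm
  set w : Fin n → ℝ → ENNReal := fun i t =>
    ENNReal.ofReal (Real.exp (l * t) / ∫ ω', Real.exp (l * ξ i ω') ∂P) with hw
  have hwm : ∀ i, Measurable ((s i).indicator (w i)) := fun i =>
    (by fun_prop : Measurable (w i)).indicator (hs i)
  have hpre : MeasurableSet ((fun ω i => ξ i ω) ⁻¹' pi univ s) :=
    hmξ (MeasurableSet.univ_pi hs)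
  rw [Measure.map_apply hmξ (MeasurableSet.univ_pi hs), conjMeasure, withDensity_apply _ hpre,
    ← lintegral_indicator hpre]
  calc _ = ∫⁻ ω, ∏ i, (s i).indicator (w i) (ξ i ω) ∂P := by
        refine lintegral_congr fun ω => ?_
        by_cases hω : ∀ i, ξ i ω ∈ s i
        · rw [indicator_of_mem (show ω ∈ (fun ω i => ξ i ω) ⁻¹' pi univ s from fun i _ => hω i),
            esscherDensity, ENNReal.ofReal_prod_of_nonneg]
          · exact Finset.prod_congr rfl fun i _ => by rw [indicator_of_mem (hω i)]
          · exact fun i _ => div_nonneg (Real.exp_pos _).le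
              (integral_nonneg fun _ => (Real.exp_pos _).le)
        · rw [indicator_of_notMem (show ω ∉ (fun ω i => ξ i ω) ⁻¹' pi univ s from
            fun h => hω fun i => h i (mem_univ i))]
          push Not at hω
          obtain ⟨i, hi⟩ := hω
          exact (Finset.prod_eq_zero (Finset.mem_univ i) (indicator_of_notMem hi _)).symm
    _ = ∏ i, ∫⁻ ω, (s i).indicator (w i) (ξ i ω) ∂P :=
        lintegral_prod_eq_prod_lintegral_of_indepFun Finset.univ _
          (hind.comp _ hwm) fun i => (hwm i).comp (hm i)
    _ = _ := by
        refine Finset.prod_congr rfl fun i _ => ?_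
        rw [Measure.map_apply (hm i) (hs i), tilted_apply' _ _ (hm i (hs i)),
          ← lintegral_indicator (hm i (hs i))]
        rfl

lemma isProbabilityMeasure_conjMeasure (hind : iIndepFun ξ P) (hm : ∀ i, Measurable (ξ i))
    (hexp : ∀ i, Integrable (fun ω => Real.exp (l * ξ i ω)) P) :
    IsProbabilityMeasure (conjMeasure P ξ l) := by
  have hTm : ∀ i, IsProbabilityMeasure ((P.tilted fun ω => l * ξ i ω).map (ξ i)) := fun i =>
    have := isProbabilityMeasure_tilted (hexp i)
    Measure.isProbabilityMeasure_map (hm i).aemeasurable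
  have hmξ : Measurable fun ω i => ξ i ω := measurable_pi_lambda _ hm
  constructor
  have := congrArg (fun μ => μ univ) (map_conjMeasure hind hm hexp)
  simpa [Measure.map_apply hmξ] using this

lemma map_conjMeasure_apply (hind : iIndepFun ξ P) (hm : ∀ i, Measurable (ξ i))
    (hexp : ∀ i, Integrable (fun ω => Real.exp (l * ξ i ω)) P) (i : Fin n) :
    (conjMeasure P ξ l).map (ξ i) = (P.tilted fun ω => l * ξ i ω).map (ξ i) := by
  have hTm : ∀ i, IsProbabilityMeasure ((P.tilted fun ω => l * ξ i ω).map (ξ i)) := fun i =>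
    have := isProbabilityMeasure_tilted (hexp i)
    Measure.isProbabilityMeasure_map (hm i).aemeasurable
  have hmξ : Measurable fun ω i => ξ i ω := measurable_pi_lambda _ hm
  have := congrArg (fun μ => μ.map (Function.eval i)) (map_conjMeasure hind hm hexp)
  simp only [Measure.map_map (measurable_pi_apply i) hmξ] at this
  rw [(measurePreserving_eval (fun i => (P.tilted fun ω => l * ξ i ω).map (ξ i)) i).map_eq] at this
  exact this

lemma iIndepFun_conjMeasure (hind : iIndepFun ξ P) (hm : ∀ i, Measurable (ξ i))
    (hexp : ∀ i, Integrable (fun ω => Real.exp (l * ξ i ω)) P) :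
    iIndepFun ξ (conjMeasure P ξ l) := by
  have := isProbabilityMeasure_conjMeasure hind hm hexp
  rw [iIndepFun_iff_map_fun_eq_pi_map fun i => (hm i).aemeasurable]
  simp only [map_conjMeasure_apply hind hm hexp]
  exact map_conjMeasure hind hm hexp

lemma integral_comp_conjMeasure (hind : iIndepFun ξ P) (hm : ∀ i, Measurable (ξ i))
    (hexp : ∀ i, Integrable (fun ω => Real.exp (l * ξ i ω)) P) (i : Fin n) {g : ℝ → ℝ}
    (hg : Measurable g) :
    ∫ ω, g (ξ i ω) ∂(conjMeasure P ξ l) =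
      (∫ ω, Real.exp (l * ξ i ω) * g (ξ i ω) ∂P) / ∫ ω, Real.exp (l * ξ i ω) ∂P := by
  rw [← integral_map (hm i).aemeasurable hg.aestronglyMeasurable,
    map_conjMeasure_apply hind hm hexp, integral_map (hm i).aemeasurable hg.aestronglyMeasurable,
    integral_tilted, ← integral_div]
  refine integral_congr_ae (Eventually.of_forall fun ω => ?_)
  simp only [smul_eq_mul]
  ring

lemma integrable_comp_conjMeasure (hind : iIndepFun ξ P) (hm : ∀ i, Measurable (ξ i))
    (hexp : ∀ i, Integrable (fun ω => Real.exp (l * ξ i ω)) P) (i : Fin n) {g : ℝ → ℝ}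
    (hg : Measurable g) (hint : Integrable (fun ω => Real.exp (l * ξ i ω) * g (ξ i ω)) P) :
    Integrable (fun ω => g (ξ i ω)) (conjMeasure P ξ l) := by
  have h1 : Integrable g ((conjMeasure P ξ l).map (ξ i)) := by
    rw [map_conjMeasure_apply hind hm hexp, integrable_map_measure hg.aestronglyMeasurable
      (hm i).aemeasurable, integrable_tilted_iff (hexp i)]
    exact hint
  exact (integrable_map_measure hg.aestronglyMeasurable (hm i).aemeasurable).1 h1

end Conjugate

/-! ### The family centered under the conjugate measure -/

section Centered

variable {Ω : Type*} [MeasurableSpace Ω] {P : Measure Ω} [IsProbabilityMeasure P] {n : ℕ}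
  {ξ : Fin n → Ω → ℝ} {δ B l : ℝ}

/-- The summands centered under the conjugate measure. -/
noncomputable def conjFamily (P : Measure Ω) (ξ : Fin n → Ω → ℝ) (l : ℝ) (i : Fin n) (ω : Ω) : ℝ :=
  ξ i ω - ∫ ω', ξ i ω' ∂(conjMeasure P ξ l)

lemma measurable_sumS (hm : ∀ i, Measurable (ξ i)) : Measurable (sumS ξ) :=
  Finset.measurable_sum _ fun i _ => hm i

omit [IsProbabilityMeasure P] in
lemma sumS_le (hξB : ∀ i, ∀ᵐ ω ∂P, ξ i ω ≤ B) : ∀ᵐ ω ∂P, sumS ξ ω ≤ n * B := by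
  filter_upwards [ae_all_iff.2 hξB] with ω hω
  calc sumS ξ ω ≤ ∑ _i : Fin n, B := Finset.sum_le_sum fun i _ => hω i
    _ = n * B := by simp

lemma IsCenteredFamily.integrable (hξ : IsCenteredFamily P δ ξ) (hδ : δ ∈ Ioc (0 : ℝ) 1)
    (i : Fin n) : Integrable (ξ i) P :=
  (hξ.memLp_two hδ i).integrable one_le_two

/-- Exponential tilting of variables bounded by `B` multiplies absolute moments by at most
`e^{Bl}`: the density is at most `e^{Bl}` because the normalizing constants are at least one. -/
lemma IsCenteredFamily.moment_conjMeasure (hξ : IsCenteredFamily P δ ξ) (hδ : δ ∈ Ioc (0 : ℝ) 1)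
    (hξB : ∀ i, ∀ᵐ ω ∂P, ξ i ω ≤ B) (hl : 0 ≤ l) (i : Fin n) :
    Integrable (fun ω => |ξ i ω| ^ (2 + δ)) (conjMeasure P ξ l) ∧
    ∫ ω, |ξ i ω| ^ (2 + δ) ∂(conjMeasure P ξ l) ≤
      Real.exp (B * l) * ∫ ω, |ξ i ω| ^ (2 + δ) ∂P := by
  have hexp : ∀ i, Integrable (fun ω => Real.exp (l * ξ i ω)) P := fun i =>
    integrable_exp_of_le (hξ.measurable i) (hξB i) hl
  have hg : Measurable fun t : ℝ => |t| ^ (2 + δ) := measurable_norm.pow_const _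
  have hint := integrable_mul_exp (hξ.measurable i) (hξB i) hl (hξ.moment i)
  refine ⟨integrable_comp_conjMeasure hξ.indep hξ.measurable hexp i hg hint, ?_⟩
  rw [integral_comp_conjMeasure hξ.indep hξ.measurable hexp i hg]
  have h0 : 0 ≤ ∫ ω, Real.exp (l * ξ i ω) * |ξ i ω| ^ (2 + δ) ∂P :=
    integral_nonneg fun ω => by positivity
  refine (div_le_self h0 (one_le_integral_exp (hξ.integrable hδ i) (hξ.mean_zero i)
    (hexp i))).trans ?_
  rw [← integral_const_mul]
  refine integral_mono_ae hint ((hξ.moment i).const_mul _) ?_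
  filter_upwards [hξB i] with ω hω
  have := exp_mul_le hl hω
  gcongr

lemma IsCenteredFamily.conjFamily (hξ : IsCenteredFamily P δ ξ) (hδ : δ ∈ Ioc (0 : ℝ) 1)
    (hξB : ∀ i, ∀ᵐ ω ∂P, ξ i ω ≤ B) (hl : 0 ≤ l) :
    IsCenteredFamily (conjMeasure P ξ l) δ (conjFamily P ξ l) := by
  have hexp : ∀ i, Integrable (fun ω => Real.exp (l * ξ i ω)) P := fun i =>
    integrable_exp_of_le (hξ.measurable i) (hξB i) hl
  have hQ := isProbabilityMeasure_conjMeasure hξ.indep hξ.measurable hexp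
  have hmom := fun i => (hξ.moment_conjMeasure hδ hξB hl i).1
  have hint : ∀ i, Integrable (ξ i) (conjMeasure P ξ l) := fun i =>
    (memLp_two_of_moment hδ (hξ.measurable i) (hmom i)).integrable one_le_two
  refine ⟨fun i => (hξ.measurable i).sub_const _, ?_, fun i => ?_, fun i => ?_, fun i => ?_⟩
  · exact (iIndepFun_conjMeasure hξ.indep hξ.measurable hexp).comp
      (fun i t => t - ∫ ω', ξ i ω' ∂(conjMeasure P ξ l)) fun i => measurable_id.sub_const _
  · -- the conjugate measure has the null sets of `P`
    rintro ⟨c, hc⟩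
    refine hξ.nondegenerate i ⟨c + ∫ ω', ξ i ω' ∂(conjMeasure P ξ l), ?_⟩
    have hac : P ≪ conjMeasure P ξ l := by
      rw [conjMeasure_eq_tilted hξ.indep hξ.measurable]
      exact absolutelyContinuous_tilted
        (integrable_exp_of_le (measurable_sumS hξ.measurable) (sumS_le hξB) hl)
    filter_upwards [hac.ae_le hc] with ω hω
    rw [← hω, SharpLD.conjFamily, sub_add_cancel]
  · exact (integral_abs_sub_mean_rpow_le (by linarith [hδ.1]) (hint i) (hmom i)).1
  · unfold SharpLD.conjFamily
    rw [integral_sub (hint i) (integrable_const _)]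
    simp

lemma IsCenteredFamily.momentSum_conjFamily_le (hξ : IsCenteredFamily P δ ξ)
    (hδ : δ ∈ Ioc (0 : ℝ) 1) (hξB : ∀ i, ∀ᵐ ω ∂P, ξ i ω ≤ B) (hl : 0 ≤ l) :
    momentSum (conjMeasure P ξ l) δ (SharpLD.conjFamily P ξ l) ≤
      2 ^ (2 + δ) * (Real.exp (B * l) * momentSum P δ ξ) := by
  have hQ := isProbabilityMeasure_conjMeasure (l := l) hξ.indep hξ.measurable fun i =>
    integrable_exp_of_le (hξ.measurable i) (hξB i) hl
  unfold momentSum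
  rw [Finset.mul_sum, Finset.mul_sum]
  refine Finset.sum_le_sum fun i _ => ?_
  obtain ⟨hmom, hle⟩ := hξ.moment_conjMeasure hδ hξB hl i
  have h2 := (integral_abs_sub_mean_rpow_le (by linarith [hδ.1])
    ((memLp_two_of_moment hδ (hξ.measurable i) hmom).integrable one_le_two) hmom).2
  refine h2.trans ?_
  gcongr

lemma IsCenteredFamily.conjSigma_eq (hξ : IsCenteredFamily P δ ξ) (hδ : δ ∈ Ioc (0 : ℝ) 1)
    (hξB : ∀ i, ∀ᵐ ω ∂P, ξ i ω ≤ B) (hl : 0 ≤ l) :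
    conjSigma P ξ l = sigma (conjMeasure P ξ l) (SharpLD.conjFamily P ξ l) := by
  have hQ := isProbabilityMeasure_conjMeasure (l := l) hξ.indep hξ.measurable fun i =>
    integrable_exp_of_le (hξ.measurable i) (hξB i) hl
  have hη := hξ.conjFamily hδ hξB hl
  unfold conjSigma sigma
  rw [← integral_sq_sum hη.indep (fun i => hη.memLp_two hδ i) hη.mean_zero]
  rfl

/-- The derivative of the cumulant function is the mean of the sum under the conjugate measure. -/
lemma IsCenteredFamily.hasDerivWithinAt_Psi (hξ : IsCenteredFamily P δ ξ) (hδ : δ ∈ Ioc (0 : ℝ) 1)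
    (hB : 0 ≤ B) (hξB : ∀ i, ∀ᵐ ω ∂P, ξ i ω ≤ B) (hl : 0 ≤ l) :
    HasDerivWithinAt (Psi P ξ) (∑ i, ∫ ω, ξ i ω ∂(conjMeasure P ξ l)) (Ici 0) l := by
  have hexp : ∀ i, Integrable (fun ω => Real.exp (l * ξ i ω)) P := fun i =>
    integrable_exp_of_le (hξ.measurable i) (hξB i) hl
  unfold Psi
  refine HasDerivWithinAt.fun_sum fun i _ => ?_
  have h1 := one_le_integral_exp (hξ.integrable hδ i) (hξ.mean_zero i) (hexp i)
  have hd := (hasDerivWithinAt_integral_exp (hξ.measurable i) (hξ.integrable hδ i) hB (hξB i)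
    hl).log (by linarith)
  have hmean := integral_comp_conjMeasure hξ.indep hξ.measurable hexp i measurable_id
  simp only [id] at hmean
  rwa [← hmean] at hd

omit [IsProbabilityMeasure P] in
/-- Change of measure, with the sum recentered at an arbitrary level `c`. -/
lemma integral_conjMeasure (hind : iIndepFun ξ P) (hm : ∀ i, Measurable (ξ i)) (c : ℝ)
    (g : Ω → ℝ) : ∫ ω, g ω ∂(conjMeasure P ξ l) =
      (∫ ω, Real.exp (l * (sumS ξ ω - c)) * g ω ∂P) / ∫ ω, Real.exp (l * (sumS ξ ω - c)) ∂P := by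
  rw [conjMeasure_eq_tilted hind hm, integral_tilted]
  have h : ∀ ω, Real.exp (l * (sumS ξ ω - c)) =
      Real.exp (-(l * c)) * Real.exp (l * sumS ξ ω) := fun ω => by
    rw [← Real.exp_add]; ring_nf
  simp only [h, mul_assoc, integral_const_mul, smul_eq_mul]
  rw [mul_div_mul_left _ _ (Real.exp_ne_zero _), ← integral_div]
  refine integral_congr_ae (Eventually.of_forall fun ω => ?_)
  simp only
  ring

/-! ### The tail probability and the exponential infimum -/

lemma integrable_exp_sumS_sub (hm : ∀ i, Measurable (ξ i)) (hξB : ∀ i, ∀ᵐ ω ∂P, ξ i ω ≤ B)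
    (hl : 0 ≤ l) (c : ℝ) : Integrable (fun ω => Real.exp (l * (sumS ξ ω - c))) P :=
  integrable_exp_of_le (B := n * B - c) ((measurable_sumS hm).sub_const c)
    (by filter_upwards [sumS_le hξB] with ω hω; linarith) hl

/-- If the conjugate measure at `l` has mean `c`, the infimum of the exponential bound for `c` is
attained at `l`: use `e^y ≥ 1 + y` under the conjugate measure. -/
lemma iInf_integral_exp_eq (hind : iIndepFun ξ P) (hm : ∀ i, Measurable (ξ i))
    (hint : ∀ i, Integrable (ξ i) P) (hξB : ∀ i, ∀ᵐ ω ∂P, ξ i ω ≤ B) (hl : 0 ≤ l) {c : ℝ}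
    (hc : ∫ ω, (sumS ξ ω - c) ∂(conjMeasure P ξ l) = 0) :
    ⨅ t : Ici (0 : ℝ), ∫ ω, Real.exp ((t : ℝ) * (sumS ξ ω - c)) ∂P =
      ∫ ω, Real.exp (l * (sumS ξ ω - c)) ∂P := by
  refine le_antisymm (ciInf_le ⟨0, ?_⟩ (⟨l, hl⟩ : Ici (0 : ℝ))) ?_
  · rintro _ ⟨t, rfl⟩
    exact integral_nonneg fun ω => (Real.exp_pos _).le
  have : Nonempty (Ici (0 : ℝ)) := ⟨⟨l, hl⟩⟩
  refine le_ciInf fun t => ?_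
  have hMi := integrable_exp_sumS_sub hm hξB hl c
  have hSi : Integrable (fun ω => sumS ξ ω - c) P :=
    (integrable_finsetSum _ fun i _ => hint i).sub (integrable_const c)
  have hMSi : Integrable (fun ω => Real.exp (l * (sumS ξ ω - c)) * (sumS ξ ω - c)) P :=
    integrable_mul_exp (B := n * B - c) ((measurable_sumS hm).sub_const c)
      (by filter_upwards [sumS_le hξB] with ω hω; linarith) hl hSi
  have hzero : ∫ ω, Real.exp (l * (sumS ξ ω - c)) * (sumS ξ ω - c) ∂P = 0 := by
    rw [integral_conjMeasure hind hm c, div_eq_zero_iff] at hc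
    exact hc.resolve_right (integral_exp_pos hMi).ne'
  calc ∫ ω, Real.exp (l * (sumS ξ ω - c)) ∂P
      = ∫ ω, (Real.exp (l * (sumS ξ ω - c)) +
          (t - l) * (Real.exp (l * (sumS ξ ω - c)) * (sumS ξ ω - c))) ∂P := by
        rw [integral_add hMi (hMSi.const_mul _), integral_const_mul, hzero, mul_zero, add_zero]
    _ ≤ _ := by
        refine integral_mono (hMi.add (hMSi.const_mul _))
          (integrable_exp_sumS_sub hm hξB t.2 c) fun ω => ?_
        have h1 := Real.add_one_le_exp ((t - l) * (sumS ξ ω - c))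
        have h2 := mul_le_mul_of_nonneg_left h1 (Real.exp_pos (l * (sumS ξ ω - c))).le
        rw [← Real.exp_add, show l * (sumS ξ ω - c) + (t - l) * (sumS ξ ω - c) =
          t * (sumS ξ ω - c) by ring] at h2
        simp only
        linarith

lemma measure_lt_sumS_eq (hind : iIndepFun ξ P) (hm : ∀ i, Measurable (ξ i))
    (hξB : ∀ i, ∀ᵐ ω ∂P, ξ i ω ≤ B) (hl : 0 ≤ l) (c : ℝ) :
    P.real {ω | c < sumS ξ ω} =
      (∫ ω, (Ioi (0 : ℝ)).indicator (fun u => Real.exp (-(l * u))) (sumS ξ ω - c)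
        ∂(conjMeasure P ξ l)) * ∫ ω, Real.exp (l * (sumS ξ ω - c)) ∂P := by
  have hMi := integrable_exp_sumS_sub hm hξB hl c
  rw [integral_conjMeasure hind hm c, div_mul_cancel₀ _ (integral_exp_pos hMi).ne',
    ← integral_indicator_one (measurableSet_lt measurable_const (measurable_sumS hm))]
  refine integral_congr_ae (Eventually.of_forall fun ω => ?_)
  by_cases h : c < sumS ξ ω
  · have h' : sumS ξ ω - c ∈ Ioi (0 : ℝ) := sub_pos.2 h
    simp only [indicator_of_mem h', ← Real.exp_add, add_neg_cancel, Real.exp_zero]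
    exact indicator_of_mem (show ω ∈ {ω | c < sumS ξ ω} from h) _
  · have h' : sumS ξ ω - c ∉ Ioi (0 : ℝ) := fun h' => h (sub_pos.1 h')
    simp only [indicator_of_notMem h', mul_zero]
    exact indicator_of_notMem (show ω ∉ {ω | c < sumS ξ ω} from h) _

end Centered

/-- For a centered family, the exponential tail functional `E e^{-lS} 1_{S > 0}` is within twice
the Lyapunov bound of its normal counterpart `Θ(lσ)`. -/
lemma IsCenteredFamily.abs_integral_exp_neg_sumS_sub_Theta_le {Ω : Type*} [MeasurableSpace Ω]
    {P : Measure Ω} [IsProbabilityMeasure P] {n : ℕ} {ξ : Fin n → Ω → ℝ} {δ l : ℝ}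
    (hξ : IsCenteredFamily P δ ξ) (hδ : δ ∈ Ioc (0 : ℝ) 1) (hn : 1 ≤ n) (hl : 0 ≤ l) :
    |∫ ω, (Ioi (0 : ℝ)).indicator (fun u => Real.exp (-(l * u))) (sumS ξ ω) ∂P -
      Theta (l * sigma P ξ)| ≤
      2 * (lyapunovConst δ * (momentSum P δ ξ / sigma P ξ ^ (2 + δ))) := by
  have hs := hξ.sigma_pos hδ hn
  have hSm : Measurable fun ω => sumS ξ ω / sigma P ξ := (measurable_sumS hξ.measurable).div_const _
  have hμ : IsProbabilityMeasure (P.map fun ω => sumS ξ ω / sigma P ξ) :=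
    Measure.isProbabilityMeasure_map hSm.aemeasurable
  have h := abs_integral_exp_neg_sub_Theta_le
    (μ := P.map fun ω => sumS ξ ω / sigma P ξ)
    (D := lyapunovConst δ * (momentSum P δ ξ / sigma P ξ ^ (2 + δ))) (fun y => ?_)
    (mul_nonneg hl hs.le)
  · rw [integral_map hSm.aemeasurable ((by fun_prop : Measurable fun u : ℝ =>
      Real.exp (-(l * sigma P ξ * u))).indicator measurableSet_Ioi).aestronglyMeasurable] at h
    have heq : ∀ ω, (Ioi (0 : ℝ)).indicator (fun u => Real.exp (-(l * sigma P ξ * u)))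
        (sumS ξ ω / sigma P ξ) =
        (Ioi (0 : ℝ)).indicator (fun u => Real.exp (-(l * u))) (sumS ξ ω) := fun ω => by
      by_cases hω : 0 < sumS ξ ω
      · rw [indicator_of_mem (show sumS ξ ω ∈ Ioi 0 from hω),
          indicator_of_mem (show sumS ξ ω / sigma P ξ ∈ Ioi 0 from div_pos hω hs)]
        field_simp
      · rw [indicator_of_notMem (show sumS ξ ω ∉ Ioi 0 from hω), indicator_of_notMem
          (show sumS ξ ω / sigma P ξ ∉ Ioi 0 from fun h' => hω ((div_pos_iff_of_pos_right hs).1 h'))]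
    simpa only [heq] using h
  · rw [map_measureReal_apply hSm measurableSet_Iic]
    have hset : (fun ω => sumS ξ ω / sigma P ξ) ⁻¹' Iic y = {ω | sumS ξ ω ≤ y * sigma P ξ} := by
      ext ω
      exact div_le_iff₀ hs
    rw [hset]
    exact hξ.abs_measure_sub_Phi_le_lyapunovConst hδ hn y

end SharpLD

theorem theorem3p1 {Ω : Type*} [MeasurableSpace Ω] (P : Measure Ω) [IsProbabilityMeasure P]
    (n : ℕ) (hn : 1 ≤ n) (ξ : Fin n → Ω → ℝ) (δ B : ℝ) (hδ : δ ∈ Set.Ioc (0 : ℝ) 1) (hB : 0 < B)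
    (hξ : SharpLD.IsCenteredFamily P δ ξ) (hξB : ∀ i, ∀ᵐ ω ∂P, ξ i ω ≤ B)
    (x : ℝ) (hx : 0 ≤ x) (lbar : ℝ) (hlbar : 0 ≤ lbar)
    (hderiv : HasDerivWithinAt (SharpLD.Psi P ξ) (x * SharpLD.sigma P ξ) (Set.Ici 0) lbar) :
    ∃ θ : ℝ, |θ| ≤ 1 ∧
      P.real {ω | x * SharpLD.sigma P ξ < SharpLD.sumS ξ ω} =
        (SharpLD.Theta (lbar * SharpLD.conjSigma P ξ lbar) + θ * SharpLD.epsX P δ B ξ lbar) *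
          ⨅ l : Set.Ici (0 : ℝ),
            ∫ ω, Real.exp ((l : ℝ) * (SharpLD.sumS ξ ω - x * SharpLD.sigma P ξ)) ∂P := by
  open SharpLD in
  have hQ := isProbabilityMeasure_conjMeasure (l := lbar) hξ.indep hξ.measurable fun i =>
    integrable_exp_of_le (hξ.measurable i) (hξB i) hlbar
  have hη := hξ.conjFamily hδ hξB hlbar
  set Q := conjMeasure P ξ lbar
  have hmean : ∑ i, ∫ ω, ξ i ω ∂Q = x * sigma P ξ :=
    (uniqueDiffOn_Ici (0 : ℝ) lbar hlbar).eq_deriv _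
      (hξ.hasDerivWithinAt_Psi hδ hB.le hξB hlbar) hderiv
  have hY : ∀ ω, sumS (conjFamily P ξ lbar) ω = sumS ξ ω - x * sigma P ξ := fun ω => by
    rw [← hmean]
    exact Finset.sum_sub_distrib _ _
  have hY0 : ∫ ω, (sumS ξ ω - x * sigma P ξ) ∂Q = 0 := by
    simp only [← hY]
    unfold sumS
    rw [integral_finsetSum _ fun i _ => hη.integrable hδ i]
    exact Finset.sum_eq_zero fun i _ => hη.mean_zero i
  have hσ := hξ.conjSigma_eq hδ hξB hlbar
  have hσpos : 0 < conjSigma P ξ lbar := hσ ▸ hη.sigma_pos hδ hn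
  have hmain := hη.abs_integral_exp_neg_sumS_sub_Theta_le hδ hn hlbar
  simp only [hY] at hmain
  rw [← hσ] at hmain
  have hC : 0 ≤ lyapunovConst δ := by
    have hR : 0 < momentSum Q δ (conjFamily P ξ lbar) / conjSigma P ξ lbar ^ (2 + δ) :=
      div_pos (hη.momentSum_pos hn) (Real.rpow_pos_of_pos hσpos _)
    exact nonneg_of_mul_nonneg_left
      (nonneg_of_mul_nonneg_right ((abs_nonneg _).trans hmain) two_pos) hR
  have hpow : 0 < conjSigma P ξ lbar ^ (2 + δ) := Real.rpow_pos_of_pos hσpos _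
  have heps : 2 * (lyapunovConst δ *
      (momentSum Q δ (conjFamily P ξ lbar) / conjSigma P ξ lbar ^ (2 + δ))) ≤
      epsX P δ B ξ lbar := by
    calc _ ≤ 2 * (lyapunovConst δ * (2 ^ (2 + δ) * (Real.exp (B * lbar) * momentSum P δ ξ) /
          conjSigma P ξ lbar ^ (2 + δ))) := by
          gcongr
          exact hξ.momentSum_conjFamily_le hδ hξB hlbar
      _ = _ := by
          rw [epsX, show (3 : ℝ) + δ = 1 + (2 + δ) by ring, Real.rpow_add two_pos 1, Real.rpow_one]
          ring
  rw [iInf_integral_exp_eq hξ.indep hξ.measurable (fun i => hξ.integrable hδ i) hξB hlbar hY0,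
    measure_lt_sumS_eq hξ.indep hξ.measurable hξB hlbar]
  set E := ∫ ω, (Set.Ioi (0 : ℝ)).indicator (fun u => Real.exp (-(lbar * u)))
    (sumS ξ ω - x * sigma P ξ) ∂Q
  have hd : |E - Theta (lbar * conjSigma P ξ lbar)| ≤ epsX P δ B ξ lbar := hmain.trans heps
  -- with no error allowed the two sides agree, and `θ = 0` avoids dividing by `epsX`
  rcases ((abs_nonneg _).trans hd).eq_or_lt with h0 | hpos
  · rw [← h0, abs_nonpos_iff, sub_eq_zero] at hd
    exact ⟨0, by simp, by rw [hd, zero_mul, add_zero]⟩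
  · refine ⟨(E - Theta (lbar * conjSigma P ξ lbar)) / epsX P δ B ξ lbar, ?_, ?_⟩
    · rwa [abs_div, abs_of_pos hpos, div_le_one hpos]
    · rw [div_mul_cancel₀ _ hpos.ne', add_sub_cancel]
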